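/- **Setting.** Consider the $2\times 2$ MIMO X channel with $M_t$ antennas at transmitter $t$ and $N_r$ antennas at receiver $r$ ($t,r\in\{1,2\}$) and constant channel matrices $\mathbf H_{rt}\in\mathbb C^{N_r\times M_t}$: receiver $r$ observes $\mathbf y_r=\sum_t\mathbf H_{rt}\mathbf x_t+\mathbf z_r$ in each channel use, with i.i.d. $\mathcal{CN}(0,1)$ noise, and each transmitter $t$ has an independent message for each receiver $r$. The entries of all $\mathbf H_{rt}$ are independent, those of $\mathbf H_{rt}$ being complex Gaussian with a common mean and a common positive variance. Degrees of freedom (DoF) $(d_{rt})$ are achievable if $d_{rt}=\lim_{\rho\to\infty}R_{rt}(\rho)/\log_2\rho$ for rates $R_{rt}(\rho)$ that are achievable with vanishing error probability under average power $\rho$ at each transmitter. **Scheme.** For $t,r\in\{1,2\}$, let $r'\ne r$ be the other receiver. The real message vector from transmitter $t$ to receiver $r$, of length $Q_{rt}\ge 1$, consists of three blocks, sent along precoding vectors in $\mathbb C^{M_t}$: $\mathbf v_{rt}^k$, which are linearly independent and lie in $\ker \mathbf H_{r't}$; $\mathbf w_{rt}^k=\mathbf j\,\mathbf v_{rt}^k$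 for at most as many indices $k$; and $\mathbf u_{rt}^k$, equally many for $t=1,2$, where the vectors $\mathbf H_{r'1}\mathbf u_{r1}^k$ are linearly independent over $\mathbb C$ and $\mathbf H_{r'2}\mathbf u_{r2}^k$ spans the same real line as $\mathbf H_{r'1}\mathbf u_{r1}^k$ for every $k$ (interference alignment). At each receiver $r$ the received precoding vectors of all desired real messages together with the interference vectors $\mathbf H_{r1}\mathbf u_{r'1}^k$ must be linearly independent over $\mathbb R$. The DoF of such a choice is $\frac12\sum_{r,t}Q_{rt}$. **Theorem 2.** Let $M_1\ge M_2\ge N_1\ge N_2\ge 1$ and $M_1+M_2\ge 2N_1+N_2$ (Case B). Then for almost every channel realization the following holds. Every choice of precoders as above makes the DoF $d_{rt}=Q_{rt}/2$ achievable with codes that transmit real streams along these precoders. The total DoF $\sum_{r,t}d_{rt}$ achievable by any codes is at most $N_1+N_2$ (the outer bound). The maximal DoF of the scheme equals $$\begin{cases} N_1+N_2-1 & \text{if } M_2=N_1=N_2\ge 2,\\ N_1+N_2-\tfrac12 & \text{if } M_2=N_1>N_2,\\ N_1+N_2 & \text{if } M_2>N_1,\end{cases}$$ and it is attained with the following lengths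 $(Q_{11},Q_{21},Q_{12},Q_{22})$, respectively: 1. $(2N_1-2,\ 2N_2-2,\ 1,\ 1)$; 2. $(2N_2-1,\ 2N_2-1,\ 2(M_2-N_2),\ 1)$; 3. $(2N_1-Q_{12},\ 2N_2-Q_{22},\ \min\{2(M_2-N_2),N_1\},\ \min\{2(M_2-N_1),N_2\})$. -/

import Mathlib

open MeasureTheory ProbabilityTheory Filter Topology
open scoped NNReal Matrix

/-! The two transmitters and the two receivers are indexed by `Fin 2`; index `0` is the node
numbered `1` in the usual numbering and index `1` is the node numbered `2`.
`M t` is the number of antennas of transmitter `t`, `N r` that of receiver `r`. In a double index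
`r t` the receiver comes first. -/

namespace MimoX

noncomputable section

/-- The other of the two nodes. -/
def other (r : Fin 2) : Fin 2 := Fin.rev r

/-! ### The channel -/

/-- The complex Gaussian law with mean `m` and variance `v` (real and imaginary parts independent,
each of variance `v / 2`). -/
def complexGaussian (m : ℂ) (v : ℝ≥0) : Measure ℂ :=
  ((gaussianReal m.re (v / 2)).prod (gaussianReal m.im (v / 2))).map
    Complex.measurableEquivRealProd.symm

instance (m : ℂ) (v : ℝ≥0) : IsProbabilityMeasure (complexGaussian m v) :=
  Measure.isProbabilityMeasure_map Complex.measurableEquivRealProd.symm.measurable.aemeasurable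

/-- A (constant) channel realization: `H r t i j` is the gain from antenna `j` of transmitter `t`
to antenna `i` of receiver `r`. -/
abbrev Channel (M N : Fin 2 → ℕ) : Type :=
  (r : Fin 2) → (t : Fin 2) → Fin (N r) → Fin (M t) → ℂ

/-- The channel matrix from transmitter `t` to receiver `r`. -/
abbrev Channel.mat {M N : Fin 2 → ℕ} (H : Channel M N) (r t : Fin 2) :
    Matrix (Fin (N r)) (Fin (M t)) ℂ := Matrix.of (H r t)

/-- The law of the random channel: all gains are independent, and those from transmitter `t` to
receiver `r` are complex Gaussian with mean `m r t` and variance `v r t`. -/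
def channelLaw (M N : Fin 2 → ℕ) (m : Fin 2 → Fin 2 → ℂ) (v : Fin 2 → Fin 2 → ℝ≥0) :
    Measure (Channel M N) :=
  Measure.pi fun r => Measure.pi fun t => Measure.pi fun _ => Measure.pi fun _ =>
    complexGaussian (m r t) (v r t)

/-! ### Precoding -/

/-- Block lengths and precoding vectors. The real message vector from transmitter `t` to receiver
`r` consists of three blocks of lengths `len₁ r t`, `len₂ r t`, `len₃ r t`, precoded by the vectors
`v r t k`, `w r t k`, `u r t k` respectively. -/
structure Precoding (M : Fin 2 → ℕ) where
  len₁ : Fin 2 → Fin 2 → ℕ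
  len₂ : Fin 2 → Fin 2 → ℕ
  len₃ : Fin 2 → Fin 2 → ℕ
  v : (r t : Fin 2) → Fin (len₁ r t) → Fin (M t) → ℂ
  w : (r t : Fin 2) → Fin (len₂ r t) → Fin (M t) → ℂ
  u : (r t : Fin 2) → Fin (len₃ r t) → Fin (M t) → ℂ

namespace Precoding

variable {M : Fin 2 → ℕ} (P : Precoding M)

/-- The index set of the real scalar messages (streams) from transmitter `t` to receiver `r`. -/
abbrev Stream (r t : Fin 2) : Type :=
  Fin (P.len₁ r t) ⊕ Fin (P.len₂ r t) ⊕ Fin (P.len₃ r t)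

/-- The precoding vector of each stream from transmitter `t` to receiver `r`. -/
def col (r t : Fin 2) : P.Stream r t → Fin (M t) → ℂ :=
  Sum.elim (P.v r t) (Sum.elim (P.w r t) (P.u r t))

/-- `Q r t`, the length of the real message vector from transmitter `t` to receiver `r`. -/
def Q (r t : Fin 2) : ℕ := P.len₁ r t + P.len₂ r t + P.len₃ r t

/-- The total number of degrees of freedom, one half per real stream. -/
def dof : ℝ := (∑ r, ∑ t, (P.Q r t : ℝ)) / 2

end Precoding

/-- `P` is a choice of block lengths and precoders for the asymmetric interference alignment and
cancelation scheme on the channel `H`. The identification of `ℂ ^ N` with `ℝ ^ (2 N)` by real and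
imaginary parts being real linear, "independent / aligned in real space" is expressed by linear
independence and spans over `ℝ` of vectors in `ℂ ^ N`. -/
structure IsScheme {M N : Fin 2 → ℕ} (H : Channel M N) (P : Precoding M) : Prop where
  /-- every transmitter has a message for every receiver (the network is an X network) -/
  active : ∀ r t, 1 ≤ P.Q r t
  /-- the vectors of the first block are independent -/
  v_indep : ∀ r t, LinearIndependent ℂ (P.v r t)
  /-- the vectors of the first block are in the null space of the channel to the unintended
  receiver -/
  v_null : ∀ r t k, H.mat (other r) t *ᵥ P.v r t k = 0
  len₂_le : ∀ r t, P.len₂ r t ≤ P.len₁ r t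
  /-- the vectors of the second block are `j` times those of the first -/
  w_eq : ∀ r t k, P.w r t k = Complex.I • P.v r t (Fin.castLE (len₂_le r t) k)
  /-- the vectors of the third block at transmitter 1 are independent modulo the null space of the
  channel to the unintended receiver -/
  u_indep : ∀ r, LinearIndependent ℂ fun k => H.mat (other r) 0 *ᵥ P.u r 0 k
  len₃_eq : ∀ r, P.len₃ r 0 = P.len₃ r 1
  /-- the third-block signals of transmitter 2 are aligned one by one, in real space, with those of
  transmitter 1 at the unintended receiver -/
  aligned : ∀ r k,
    Submodule.span ℝ {H.mat (other r) 1 *ᵥ P.u r 1 (Fin.cast (len₃_eq r) k)} =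
      Submodule.span ℝ {H.mat (other r) 0 *ᵥ P.u r 0 k}
  /-- at each receiver the desired signals, together with the aligned interference, are independent
  in real space -/
  separable : ∀ r, LinearIndependent ℝ
    (Sum.elim (fun s : (t : Fin 2) × P.Stream r t => H.mat r s.1 *ᵥ P.col r s.1 s.2)
      (fun k : Fin (P.len₃ (other r) 0) => H.mat r 0 *ᵥ P.u (other r) 0 k))

/-- The numbers of degrees of freedom that the scheme offers on the channel `H`. -/
def schemeDoFs {M N : Fin 2 → ℕ} (H : Channel M N) : Set ℝ :=
  {D | ∃ P : Precoding M, IsScheme H P ∧ P.dof = D}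

/-! ### Codes, rates and degrees of freedom -/

/-- A code of block length `n` for the X channel: `msg r t` messages from transmitter `t` to
receiver `r`; transmitter `t` encodes its two messages, receiver `r` decodes its two messages. -/
structure Code (M N : Fin 2 → ℕ) (n : ℕ) where
  msg : Fin 2 → Fin 2 → ℕ
  enc : (t : Fin 2) → ((r : Fin 2) → Fin (msg r t)) → Fin n → Fin (M t) → ℂ
  dec : (r : Fin 2) → (Fin n → Fin (N r) → ℂ) → (t : Fin 2) → Fin (msg r t)
  measurable_dec : ∀ r, Measurable (dec r)

/-- The law of the noise at receiver `r` over `n` channel uses: i.i.d. `CN(0, 1)` entries. -/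
def noise (N : Fin 2 → ℕ) (n : ℕ) (r : Fin 2) : Measure (Fin n → Fin (N r) → ℂ) :=
  Measure.pi fun _ => Measure.pi fun _ => complexGaussian 0 1

namespace Code

variable {M N : Fin 2 → ℕ} {n : ℕ} (c : Code M N n)

/-- A choice of all four messages. -/
abbrev Msgs : Type := (r : Fin 2) → (t : Fin 2) → Fin (c.msg r t)

/-- The signal received by receiver `r` when the messages `W` are sent and the noise is `z`. -/
def received (H : Channel M N) (r : Fin 2) (W : c.Msgs) (z : Fin n → Fin (N r) → ℂ) :
    Fin n → Fin (N r) → ℂ :=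
  fun τ => (∑ t, H.mat r t *ᵥ c.enc t (fun r' => W r' t) τ) + z τ

/-- The probability that receiver `r` makes an error, the messages being uniformly distributed. -/
def errorProb (H : Channel M N) (r : Fin 2) : ℝ :=
  (∑ W : c.Msgs, (noise N n r).real {z | c.dec r (c.received H r W z) ≠ W r}) /
    Fintype.card c.Msgs

/-- Each transmitter has average power at most `ρ`. -/
def HasPower (ρ : ℝ) : Prop :=
  ∀ t W, ∑ τ, ∑ i, ‖c.enc t W τ i‖ ^ 2 ≤ n * ρ

/-- The code transmits real streams with the precoding vectors of `P`: each message from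
transmitter `t` to receiver `r` is encoded, separately, into real symbols, one per stream and
channel use, and transmitter `t` sends the sum of its precoded streams. -/
def UsesPrecoding (P : Precoding M) : Prop :=
  ∃ s : (r t : Fin 2) → Fin (c.msg r t) → Fin n → P.Stream r t → ℝ,
    ∀ t W τ, c.enc t W τ = ∑ r, ∑ k, ((s r t (W r) τ k : ℝ) : ℂ) • P.col r t k

end Code

/-- The rates `R r t` (in bits per channel use) are achievable at power `ρ` with vanishing
probability of error, by codes from the class `allowed`. -/
def AchievableRates {M N : Fin 2 → ℕ} (allowed : (n : ℕ) → Code M N n → Prop)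
    (H : Channel M N) (ρ : ℝ) (R : Fin 2 → Fin 2 → ℝ) : Prop :=
  ∀ ε : ℝ, 0 < ε → ∃ n₀ : ℕ, ∀ n ≥ n₀, ∃ c : Code M N n, allowed n c ∧ c.HasPower ρ ∧
    (∀ r t, n * (R r t - ε) ≤ Real.logb 2 (c.msg r t)) ∧ ∀ r, c.errorProb H r ≤ ε

/-- The degrees of freedom `d r t` are achievable on the channel `H` by codes from the class
`allowed`: `d r t` is the limit of `R r t / log₂ ρ` for achievable rates `R` at power `ρ`. -/
def AchievableDoF {M N : Fin 2 → ℕ} (allowed : (n : ℕ) → Code M N n → Prop)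
    (H : Channel M N) (d : Fin 2 → Fin 2 → ℝ) : Prop :=
  ∃ R : ℝ → Fin 2 → Fin 2 → ℝ, (∀ ρ, 0 < ρ → AchievableRates allowed H ρ (R ρ)) ∧
    ∀ r t, Tendsto (fun ρ => R ρ r t / Real.logb 2 ρ) atTop (𝓝 (d r t))

end

end MimoX

/-!
The statement has three independent parts.

*Generic channels.* Everything that is needed of the channel is that certain matrices have full
rank: the matrix from each transmitter to both receivers together, and for each receiver `r` the
matrix that sends a pair of transmit vectors to what `r` hears of both and to what the other
receiver hears of each (`Generic`). A determinant is polynomial along every complex line, so by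
Fubini it vanishes with probability zero as soon as it is nonzero for one channel
(`NegligibleZeros.pi`, `ae_generic`).

*The scheme.* Independence at receiver `r` bounds the number of desired and interfering streams by
`2 * N r` (`IsScheme.card_le`), and where transmitter `1` has no null space to hide in, its stream
has to be an aligned one (`IsScheme.one_le_len₃`). This gives the upper bounds. For the
constructions, the signals that a transmitter can send to `r` hidden from the other receiver form a
complex subspace of known dimension, and the two subspaces together span everything at `r`. If
`M 1 > N 0`, one chooses a complex basis from the two subspaces; for odd lengths the two
transmitters share one complex direction `c`, along `c` and `j c`
(`Generic.exists_zeroForcing`). If `M 1 = N 0`, transmitter `0` can prescribe the signals at both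
receivers, and aligns with the single streams of transmitter `1`, the rest of the complex line that
these leave being used by transmitter `0` or by the other stream of transmitter `1`
(`Generic.exists_scheme_square`, `Generic.exists_scheme_unequal`).

*Codes.* Since the received precoding vectors are independent over `ℝ`, real linear functionals
separate the streams at each receiver (`IsScheme.exists_separation`). On each stream a word of a
Gilbert–Varshamov code over an alphabet of `L` equally spaced real symbols is sent; with a large
constant spacing symbol errors are rare, so that a small relative minimum distance suffices, and
`L` of order `√ρ` gives half a degree of freedom (`IsScheme.exists_spacing`,
`IsScheme.achievableDoF`). For the outer bound, the law of each received block is at most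
`s ^ (n * N r) * exp (2 * n)` times one Gaussian law of variance `s`, of order `ρ`, which is the
same for all messages; as decoding regions are disjoint, summing over all messages bounds their
number (`Code.card_msgs_le`, `AchievableDoF.sum_le`).
-/

namespace MimoX

/-! ### Generic channels -/

/-- `f` is polynomial along every complex line. -/
def LinePolynomial {X : Type*} [AddCommGroup X] [Module ℂ X] (f : X → ℂ) : Prop :=
  ∀ x y, ∃ p : Polynomial ℂ, ∀ t : ℂ, f (x + t • y) = p.eval t

/-- A nonzero measurable function that is polynomial along every complex line vanishes almost
nowhere for `μ`. -/
def NegligibleZeros {X : Type*} [AddCommGroup X] [Module ℂ X] [MeasurableSpace X]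
    (μ : Measure X) : Prop :=
  ∀ f : X → ℂ, Measurable f → LinePolynomial f → (∃ x, f x ≠ 0) → ∀ᵐ x ∂μ, f x ≠ 0

theorem negligibleZeros_complexGaussian (m : ℂ) {v : ℝ≥0} (hv : v ≠ 0) :
    NegligibleZeros (complexGaussian m v) := by
  intro f hf hp ⟨x, hx⟩
  obtain ⟨p, hp⟩ := hp 0 1
  have hfp : ∀ t, f t = p.eval t := fun t => by simpa using hp t
  have hp0 : p ≠ 0 := by
    rintro rfl
    exact hx (by simp [hfp])
  have hfin : {t : ℂ | f t = 0}.Finite := by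
    refine (p.roots.toFinset.finite_toSet).subset fun t ht => ?_
    have : p.eval t = 0 := by rw [← hfp]; exact ht
    simpa [hp0] using this
  have hv2 : v / 2 ≠ 0 := div_ne_zero hv two_ne_zero
  have hpt : ∀ z : ℂ, complexGaussian m v {z} = 0 := by
    intro z
    rw [complexGaussian, MeasurableEquiv.map_apply]
    have : (Complex.measurableEquivRealProd.symm ⁻¹' {z}) ⊆ {z.re} ×ˢ {z.im} := by
      rintro ⟨a, b⟩ h
      have h : Complex.measurableEquivRealProd.symm (a, b) = z := h
      subst h
      simp [Complex.measurableEquivRealProd]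
    refine measure_mono_null this ?_
    have := nullSingletonClass_gaussianReal (μ := m.re) hv2
    rw [Measure.prod_prod]
    simp
  rw [ae_iff]
  have : {a | ¬f a ≠ 0} = ⋃ z ∈ {t : ℂ | f t = 0}, {z} := by
    ext; simp
  rw [this, measure_biUnion_null_iff hfin.countable]
  exact fun z _ => hpt z

theorem NegligibleZeros.pi {n : ℕ} {X : Fin n → Type*} [∀ i, AddCommGroup (X i)]
    [∀ i, Module ℂ (X i)] [∀ i, MeasurableSpace (X i)] {μ : (i : Fin n) → Measure (X i)}
    [∀ i, IsProbabilityMeasure (μ i)] (h : ∀ i, NegligibleZeros (μ i)) :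
    NegligibleZeros (Measure.pi μ) := by
  induction n with
  | zero =>
    intro f _ _ ⟨x, hx⟩
    refine ae_of_all _ fun y => ?_
    rwa [Subsingleton.elim y x]
  | succ n ih =>
    intro f hf hp ⟨x₀, hx₀⟩
    have e := measurePreserving_piFinSuccAbove μ 0
    set E := MeasurableEquiv.piFinSuccAbove X 0
    have hE₀ : ∀ z, E.symm z 0 = z.1 := fun z => Fin.insertNth_apply_same 0 z.1 z.2
    have hE₁ : ∀ z j, E.symm z (Fin.succAbove 0 j) = z.2 j :=
      fun z j => Fin.insertNth_apply_succAbove 0 z.1 z.2 j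
    -- Nonvanishing at one point spreads to almost every first coordinate, then to the others.
    have key : ∀ᵐ z ∂((μ 0).prod (Measure.pi fun j => μ (Fin.succAbove 0 j))),
        f (E.symm z) ≠ 0 := by
      have hm : Measurable fun z => f (E.symm z) := hf.comp E.symm.measurable
      rw [Measure.ae_prod_iff_ae_ae (p := fun z => f (E.symm z) ≠ 0)
        (hm (measurableSet_singleton 0).compl)]
      have h1 : ∀ᵐ a ∂(μ 0), f (E.symm (a, (E x₀).2)) ≠ 0 := by
        refine h 0 (fun a => f (E.symm (a, (E x₀).2)))
          (hm.comp (measurable_id.prodMk measurable_const)) (fun x y => ?_) ⟨(E x₀).1, ?_⟩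
        · obtain ⟨p, hp⟩ := hp (E.symm (x, (E x₀).2)) (E.symm (y, 0))
          refine ⟨p, fun t => ?_⟩
          rw [← hp]
          refine congrArg f (funext fun i => ?_)
          refine Fin.succAboveCases 0 ?_ (fun j => ?_) i <;>
            simp only [hE₀, hE₁, Pi.add_apply, Pi.smul_apply, Pi.zero_apply, smul_zero, add_zero]
        · change f (E.symm (E x₀)) ≠ 0
          rwa [E.symm_apply_apply]
      filter_upwards [h1] with a ha
      refine ih (X := fun j => X (Fin.succAbove 0 j)) (fun j => h _) (fun b => f (E.symm (a, b)))
        (hm.comp (measurable_const.prodMk measurable_id)) (fun x y => ?_) ⟨_, ha⟩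
      obtain ⟨p, hp⟩ := hp (E.symm (a, x)) (E.symm (0, y))
      refine ⟨p, fun t => ?_⟩
      rw [← hp]
      refine congrArg f (funext fun i => ?_)
      refine Fin.succAboveCases 0 ?_ (fun j => ?_) i <;>
        simp only [hE₀, hE₁, Pi.add_apply, Pi.smul_apply, smul_zero, add_zero]
    filter_upwards [e.quasiMeasurePreserving.ae key] with x hx
    rwa [E.symm_apply_apply] at hx

theorem negligibleZeros_channelLaw (M N : Fin 2 → ℕ) (m : Fin 2 → Fin 2 → ℂ)
    {v : Fin 2 → Fin 2 → ℝ≥0} (hv : ∀ r t, v r t ≠ 0) :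
    NegligibleZeros (channelLaw M N m v) :=
  .pi fun _ => .pi fun _ => .pi fun _ => .pi fun _ => negligibleZeros_complexGaussian _ (hv _ _)

theorem LinePolynomial.det {X n : Type*} [AddCommGroup X] [Module ℂ X] [Fintype n] [DecidableEq n]
    {A : X → Matrix n n ℂ} (hA : ∀ i j, LinePolynomial fun x => A x i j) :
    LinePolynomial fun x => (A x).det := by
  intro x y
  choose p hp using fun i j => hA i j x y
  refine ⟨(Matrix.of p).det, fun t => ?_⟩
  rw [← Polynomial.coe_evalRingHom, RingHom.map_det]
  refine congrArg Matrix.det (Matrix.ext fun i j => ?_)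
  simpa using hp i j t

theorem LinePolynomial.mul_right {X : Type*} [AddCommGroup X] [Module ℂ X]
    {f : X → ℂ} (hf : LinePolynomial f) (c : ℂ) : LinePolynomial fun x => f x * c := by
  intro x y
  obtain ⟨p, hp⟩ := hf x y
  exact ⟨p * Polynomial.C c, fun t => by simp [hp]⟩

theorem LinePolynomial.mul_left {X : Type*} [AddCommGroup X] [Module ℂ X]
    {f : X → ℂ} (hf : LinePolynomial f) (c : ℂ) : LinePolynomial fun x => c * f x := by
  simpa only [mul_comm] using hf.mul_right c

theorem LinePolynomial.sum {X κ : Type*} [AddCommGroup X] [Module ℂ X] [Fintype κ]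
    {f : κ → X → ℂ} (hf : ∀ k, LinePolynomial (f k)) : LinePolynomial fun x => ∑ k, f k x := by
  intro x y
  choose p hp using fun k => hf k x y
  exact ⟨∑ k, p k, fun t => by simp [hp, Polynomial.eval_finsetSum]⟩

theorem measurable_matrix_det {X n : Type*} [MeasurableSpace X] [Fintype n] [DecidableEq n]
    {A : X → Matrix n n ℂ} (hA : ∀ i j, Measurable fun x => A x i j) :
    Measurable fun x => (A x).det := by
  simp only [Matrix.det_apply']
  fun_prop

section FullRank

variable {X : Type*} [AddCommGroup X] [Module ℂ X] [MeasurableSpace X] {μ : Measure X}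
  {m n : Type*} [Fintype m] [Fintype n]

/-- Surjectivity is generic: a polynomial family of matrices with one surjective member is
surjective almost everywhere, since with a right inverse `S` of that member the determinant of
`A x * S` is not identically zero. -/
theorem NegligibleZeros.ae_surjective [DecidableEq m] (hμ : NegligibleZeros μ)
    {A : X → Matrix m n ℂ}
    (hm : ∀ i j, Measurable fun x => A x i j) (hp : ∀ i j, LinePolynomial fun x => A x i j)
    (x₀ : X) (h₀ : Function.Surjective (A x₀).mulVec) :
    ∀ᵐ x ∂μ, Function.Surjective (A x).mulVec := by
  obtain ⟨S, hS⟩ := Matrix.mulVec_surjective_iff_exists_right_inverse.1 h₀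
  have := hμ (fun x => (A x * S).det)
    (measurable_matrix_det fun i j => by simp only [Matrix.mul_apply]; fun_prop)
    (LinePolynomial.det fun i j => by
      simp only [Matrix.mul_apply]; exact .sum fun k => (hp i k).mul_right _) ⟨x₀, by simp [hS]⟩
  filter_upwards [this] with x hx
  refine Matrix.mulVec_surjective_iff_exists_right_inverse.2 ⟨S * (A x * S)⁻¹, ?_⟩
  rw [← Matrix.mul_assoc, Matrix.mul_nonsing_inv _ (isUnit_iff_ne_zero.2 hx)]

/-- Injectivity is generic, by the argument of `NegligibleZeros.ae_surjective` with a left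
inverse. -/
theorem NegligibleZeros.ae_injective [DecidableEq n] (hμ : NegligibleZeros μ) {A : X → Matrix m n ℂ}
    (hm : ∀ i j, Measurable fun x => A x i j) (hp : ∀ i j, LinePolynomial fun x => A x i j)
    (x₀ : X) (h₀ : Function.Injective (A x₀).mulVec) :
    ∀ᵐ x ∂μ, Function.Injective (A x).mulVec := by
  classical
  obtain ⟨g, hg⟩ := (Matrix.toLin' (A x₀)).exists_leftInverse_of_injective
    (LinearMap.ker_eq_bot.2 h₀)
  have hS : LinearMap.toMatrix' g * A x₀ = 1 := by
    rw [← LinearMap.toMatrix'_toLin' (A x₀), ← LinearMap.toMatrix'_comp, hg,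
      LinearMap.toMatrix'_id]
  set S := LinearMap.toMatrix' g
  have := hμ (fun x => (S * A x).det)
    (measurable_matrix_det fun i j => by simp only [Matrix.mul_apply]; fun_prop)
    (LinePolynomial.det fun i j => by
      simp only [Matrix.mul_apply]; exact .sum fun k => (hp k j).mul_left _) ⟨x₀, by simp [hS]⟩
  filter_upwards [this] with x hx
  refine Function.LeftInverse.injective (g := ((S * A x)⁻¹ * S).mulVec) fun z => ?_
  rw [Matrix.mulVec_mulVec, Matrix.mul_assoc,
    Matrix.nonsing_inv_mul _ (isUnit_iff_ne_zero.2 hx), Matrix.one_mulVec]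

omit [MeasurableSpace X] in
theorem linePolynomial_const (c : ℂ) : LinePolynomial fun _ : X => c :=
  fun _ _ => ⟨Polynomial.C c, fun t => by simp⟩

end FullRank

section Generic

variable {M N : Fin 2 → ℕ}

theorem linePolynomial_entry (r t : Fin 2) (i : Fin (N r)) (j : Fin (M t)) :
    LinePolynomial fun H : Channel M N => H r t i j := by
  intro H K
  exact ⟨Polynomial.C (H r t i j) + Polynomial.X * Polynomial.C (K r t i j), fun t => by
    simp [mul_comm t]⟩

/-- The channel from transmitter `t` to both receivers. -/
def stacked (t : Fin 2) (H : Channel M N) : Matrix (Fin (N 0) ⊕ Fin (N 1)) (Fin (M t)) ℂ :=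
  Matrix.fromRows (H.mat 0 t) (H.mat 1 t)

/-- The matrix whose surjectivity says that the signals at receiver `r` and, for each transmitter
separately, the signals at the other receiver can be prescribed together. -/
def crossed (r : Fin 2) (H : Channel M N) :
    Matrix (Fin (N r) ⊕ (Fin (N (other r)) ⊕ Fin (N (other r)))) (Fin (M 0) ⊕ Fin (M 1)) ℂ :=
  Matrix.fromRows (Matrix.fromCols (H.mat r 0) (H.mat r 1))
    (Matrix.fromBlocks (H.mat (other r) 0) 0 0 (H.mat (other r) 1))

theorem other_ne (r : Fin 2) : other r ≠ r := by fin_cases r <;> decide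

/-- What is needed of a channel realization: the channels to both receivers together have full
rank, and the matrices `crossed r H` are surjective. -/
structure Generic (H : Channel M N) : Prop where
  exists_both : ∀ t, N 0 + N 1 ≤ M t → ∀ a b, ∃ x, H.mat 0 t *ᵥ x = a ∧ H.mat 1 t *ᵥ x = b
  eq_zero : ∀ t, M t ≤ N 0 + N 1 → ∀ x, H.mat 0 t *ᵥ x = 0 → H.mat 1 t *ᵥ x = 0 → x = 0
  exists_crossed : ∀ r a b c, ∃ x y, H.mat r 0 *ᵥ x + H.mat r 1 *ᵥ y = a ∧
    H.mat (other r) 0 *ᵥ x = b ∧ H.mat (other r) 1 *ᵥ y = c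

/-- The witness for `stacked`: antenna `j` of the transmitter is heard by receive antenna `j`
only, receive antennas being numbered through both receivers. -/
def diagonalChannel (M N : Fin 2 → ℕ) : Channel M N :=
  fun r _ i j => if (j : ℕ) = (if r = 0 then (i : ℕ) else N 0 + i) then 1 else 0

theorem stacked_diagonalChannel_mulVec (t : Fin 2) (x : Fin (M t) → ℂ) (s : Fin (N 0) ⊕ Fin (N 1))
    (j : Fin (M t)) (h : (j : ℕ) = finSumFinEquiv s) :
    (stacked t (diagonalChannel M N) *ᵥ x) s = x j := by
  have : ∀ k : Fin (M t), stacked t (diagonalChannel M N) s k = if k = j then 1 else 0 := by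
    intro k
    rcases s with s | s <;> simp_all [stacked, diagonalChannel, Fin.ext_iff]
  simp [Matrix.mulVec, dotProduct, this]

theorem measurable_stacked (t : Fin 2) (s j) :
    Measurable fun H : Channel M N => stacked t H s j := by
  rcases s with s | s <;> simp only [stacked, Matrix.fromRows_apply_inl,
    Matrix.fromRows_apply_inr, Channel.mat, Matrix.of_apply] <;> fun_prop

theorem linePolynomial_stacked (t : Fin 2) (s j) :
    LinePolynomial fun H : Channel M N => stacked t H s j := by
  rcases s with s | s <;> exact linePolynomial_entry _ _ _ _

theorem measurable_crossed (r : Fin 2) (s j) :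
    Measurable fun H : Channel M N => crossed r H s j := by
  rcases s with s | s | s <;> rcases j with j | j <;> simp [crossed] <;> fun_prop

theorem linePolynomial_crossed (r : Fin 2) (s j) :
    LinePolynomial fun H : Channel M N => crossed r H s j := by
  rcases s with s | s | s <;> rcases j with j | j
  · exact linePolynomial_entry _ _ _ _
  · exact linePolynomial_entry _ _ _ _
  · exact linePolynomial_entry _ _ _ _
  · exact linePolynomial_const 0
  · exact linePolynomial_const 0
  · exact linePolynomial_entry _ _ _ _

theorem crossed_mulVec (r : Fin 2) (H : Channel M N) (x : Fin (M 0) → ℂ) (y : Fin (M 1) → ℂ) :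
    crossed r H *ᵥ Sum.elim x y = Sum.elim (H.mat r 0 *ᵥ x + H.mat r 1 *ᵥ y)
      (Sum.elim (H.mat (other r) 0 *ᵥ x) (H.mat (other r) 1 *ᵥ y)) := by
  simp [crossed, Matrix.fromRows_mulVec, Matrix.fromBlocks_mulVec]

/-- The witness for `crossed r`: at the other receiver the first antennas of each transmitter are
heard one by one; at receiver `r` the remaining antennas of transmitter `0` are heard one by one
from the first receive antenna upwards, those of transmitter `1` from the last one downwards. -/
def crossedChannel (M N : Fin 2 → ℕ) (r : Fin 2) : Channel M N :=
  fun r' t i j => if (j : ℕ) = (if r' = r then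
    (if t = 0 then N (other r) + i else N (other r) + (N r - 1 - i)) else (i : ℕ)) then 1 else 0

theorem sum_ite_val_eq {k : ℕ} (f : Fin k → ℂ) (l : ℕ) :
    ∑ j : Fin k, (if (j : ℕ) = l then 1 else 0) * f j = if h : l < k then f ⟨l, h⟩ else 0 := by
  split_ifs with h
  · have : ∀ j : Fin k, ((j : ℕ) = l) = (j = ⟨l, h⟩) := fun j => by simp [Fin.ext_iff]
    simp [this]
  · refine Finset.sum_eq_zero fun j _ => ?_
    rw [if_neg (by have := j.2; omega), zero_mul]

theorem crossed_crossedChannel_surjective (r : Fin 2) (h0 : N (other r) ≤ M 0)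
    (h1 : N (other r) ≤ M 1) (h : N r + 2 * N (other r) ≤ M 0 + M 1) :
    Function.Surjective (crossed r (crossedChannel M N r)).mulVec := by
  intro z
  refine ⟨Sum.elim
    (fun j => if hj : (j : ℕ) < N (other r) then z (.inr (.inl ⟨j, hj⟩)) else
      if hj : (j : ℕ) - N (other r) < N r then z (.inl ⟨j - N (other r), hj⟩) else 0)
    (fun j => if hj : (j : ℕ) < N (other r) then z (.inr (.inr ⟨j, hj⟩)) else
      if hj : j - N (other r) < N r ∧ M 0 ≤ N (other r) + (N r - 1 - (j - N (other r))) then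
        z (.inl ⟨N r - 1 - (j - N (other r)), by omega⟩) else 0), ?_⟩
  rw [crossed_mulVec]
  ext s
  rcases s with s | s | s
  · have hs := s.2
    simp only [Channel.mat, Sum.elim_inl, Pi.add_apply, Matrix.mulVec, dotProduct, Matrix.of_apply,
      crossedChannel, if_true, one_ne_zero, if_false, sum_ite_val_eq]
    by_cases hM : N (other r) + s < M 0
    · have e : N r - 1 - (N r - 1 - (s : ℕ)) = s := by omega
      have : ¬ M 0 ≤ N (other r) + s := by omega
      simp [hM, e, this]
    · have e : N r - 1 - (N r - 1 - (s : ℕ)) = s := by omega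
      have h2 : M 0 ≤ N (other r) + s := by omega
      have h3 : N (other r) + (N r - 1 - s) < M 1 := by omega
      have h4 : N r - 1 - (s : ℕ) < N r := by omega
      simp [hM, e, h2, h3, h4]
  · simp only [Channel.mat, Sum.elim_inr, Sum.elim_inl, Matrix.mulVec, dotProduct,
      Matrix.of_apply, crossedChannel, other_ne, if_false, sum_ite_val_eq, s.2.trans_le h0, s.2,
      dif_pos]
  · simp only [Channel.mat, Sum.elim_inr, Matrix.mulVec, dotProduct,
      Matrix.of_apply, crossedChannel, other_ne, if_false, sum_ite_val_eq, s.2.trans_le h1, s.2,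
      dif_pos]

theorem ae_generic (hM : M 1 ≤ M 0) (hMN : N 0 ≤ M 1) (hN : N 1 ≤ N 0)
    (hB : 2 * N 0 + N 1 ≤ M 0 + M 1) (m : Fin 2 → Fin 2 → ℂ) {v : Fin 2 → Fin 2 → ℝ≥0}
    (hv : ∀ r t, v r t ≠ 0) : ∀ᵐ H ∂channelLaw M N m v, Generic H := by
  have hμ := negligibleZeros_channelLaw M N m hv
  have hs : ∀ᵐ H ∂channelLaw M N m v, ∀ t, N 0 + N 1 ≤ M t →
      Function.Surjective (stacked t H).mulVec := by
    refine ae_all_iff.2 fun t => ?_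
    by_cases h : N 0 + N 1 ≤ M t
    · simp only [h, true_imp_iff]
      refine hμ.ae_surjective (measurable_stacked t) (linePolynomial_stacked t)
        (diagonalChannel M N) fun z => ⟨fun j => if hj : (j : ℕ) < N 0 + N 1 then
          z (finSumFinEquiv.symm ⟨j, hj⟩) else 0, funext fun s => ?_⟩
      rw [stacked_diagonalChannel_mulVec t _ s ⟨finSumFinEquiv s, by omega⟩ rfl]
      simp
    · simp [h]
  have hi : ∀ᵐ H ∂channelLaw M N m v, ∀ t, M t ≤ N 0 + N 1 →
      Function.Injective (stacked t H).mulVec := by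
    refine ae_all_iff.2 fun t => ?_
    by_cases h : M t ≤ N 0 + N 1
    · simp only [h, true_imp_iff]
      refine hμ.ae_injective (measurable_stacked t) (linePolynomial_stacked t)
        (diagonalChannel M N) fun x y hxy => funext fun j => ?_
      have := congrFun hxy (finSumFinEquiv.symm ⟨j, by omega⟩)
      rwa [stacked_diagonalChannel_mulVec t _ _ j (by simp),
        stacked_diagonalChannel_mulVec t _ _ j (by simp)] at this
    · simp [h]
  have hc : ∀ᵐ H ∂channelLaw M N m v, ∀ r, Function.Surjective (crossed r H).mulVec := by
    refine ae_all_iff.2 fun r => hμ.ae_surjective (measurable_crossed r) (linePolynomial_crossed r)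
      (crossedChannel M N r) (crossed_crossedChannel_surjective r ?_ ?_ ?_)
    all_goals fin_cases r <;> simp [other] <;> omega
  filter_upwards [hs, hi, hc] with H hs hi hc
  refine ⟨fun t ht a b => ?_, fun t ht x h0 h1 => ?_, fun r a b c => ?_⟩
  · obtain ⟨x, hx⟩ := hs t ht (Sum.elim a b)
    rw [stacked, Matrix.fromRows_mulVec, Sum.elim_eq_iff] at hx
    exact ⟨x, hx⟩
  · refine hi t ht ?_
    simp [stacked, Matrix.fromRows_mulVec, h0, h1]
  · obtain ⟨z, hz⟩ := hc r (Sum.elim a (Sum.elim b c))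
    rw [← Sum.elim_comp_inl_inr z, crossed_mulVec, Sum.elim_eq_iff, Sum.elim_eq_iff] at hz
    exact ⟨_, _, hz⟩

end Generic

/-! ### Bases adapted to two subspaces -/

section Adapted

variable {V : Type*} [AddCommGroup V] [Module ℂ V]

/-- Complex multiples by `1` (for `false`) and by `j` (for `true`). -/
def phase (b : Bool) : ℂ := if b then Complex.I else 1

@[simp] theorem phase_false : phase false = 1 := rfl
@[simp] theorem phase_true : phase true = Complex.I := rfl

/-- A family that uses each of `e k`, `j e k` at most once is independent over `ℝ`
when `e` is independent over `ℂ`. -/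
theorem linearIndependent_phase {κ σ : Type*} {e : κ → V} (he : LinearIndependent ℂ e)
    {g : σ → V} (φ : σ → Bool × κ) (hφ : Function.Injective φ)
    (hg : ∀ s, g s = phase (φ s).1 • e (φ s).2) : LinearIndependent ℝ g := by
  have hb : LinearIndependent ℝ phase := by
    rw [Fintype.linearIndependent_iff]
    intro c hc
    have hc : (c true : ℂ) * Complex.I + c false = 0 := by simpa using hc
    have h1 := congrArg Complex.re hc
    have h2 := congrArg Complex.im hc
    simp only [Complex.add_re, Complex.add_im, Complex.mul_re, Complex.mul_im, Complex.ofReal_re,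
      Complex.ofReal_im, Complex.I_re, Complex.I_im, Complex.zero_re, Complex.zero_im] at h1 h2
    rintro (_ | _) <;> linarith
  have := (linearIndependent_smul (A := V) hb he).comp φ hφ
  rwa [show g = (fun p : Bool × κ => phase p.1 • e p.2) ∘ φ from funext hg]

/-- A complement of `A` can be found inside `B`. -/
theorem exists_isCompl_le_of_sup_eq_top [FiniteDimensional ℂ V] {A B : Submodule ℂ V}
    (h : A ⊔ B = ⊤) :
    ∃ D ≤ B, IsCompl A D := by
  obtain ⟨D, hD⟩ := exists_isCompl (A ⊓ B)
  refine ⟨D ⊓ B, inf_le_right, ?_, ?_⟩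
  · rw [disjoint_iff]
    rw [inf_comm D, ← inf_assoc]
    exact hD.disjoint.eq_bot
  · rw [codisjoint_iff, eq_top_iff, ← h]
    refine sup_le le_sup_left ?_
    calc B = (A ⊓ B ⊔ D) ⊓ B := by rw [hD.sup_eq_top, top_inf_eq]
      _ = A ⊓ B ⊔ D ⊓ B := by rw [sup_inf_assoc_of_le _ inf_le_right]
      _ ≤ _ := sup_le_sup_right inf_le_left _

theorem exists_le_le_finrank_eq [FiniteDimensional ℂ V] {C A : Submodule ℂ V} (hCA : C ≤ A) {p : ℕ}
    (h1 : Module.finrank ℂ C ≤ p) (h2 : p ≤ Module.finrank ℂ A) :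
    ∃ A', C ≤ A' ∧ A' ≤ A ∧ Module.finrank ℂ A' = p := by
  induction p, h1 using Nat.le_induction with
  | base => exact ⟨C, le_rfl, hCA, rfl⟩
  | succ p hp ih =>
    obtain ⟨A', h1, h2', h3⟩ := ih (by omega)
    have hne : ¬ A ≤ A' := fun h => by
      have := Submodule.finrank_mono h
      omega
    obtain ⟨x, hxA, hx⟩ := SetLike.not_le_iff_exists.1 hne
    refine ⟨A' ⊔ ℂ ∙ x, h1.trans le_sup_left, sup_le h2' ?_, ?_⟩
    · rwa [Submodule.span_singleton_le_iff_mem]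
    · have hx0 : x ≠ 0 := fun h => hx (h ▸ A'.zero_mem)
      have hd : A' ⊓ (ℂ ∙ x) = ⊥ := by
        rw [← disjoint_iff]; exact (Submodule.disjoint_span_singleton' hx0).2 hx
      have := Submodule.finrank_sup_add_finrank_inf_eq A' (ℂ ∙ x)
      rw [hd, finrank_bot, finrank_span_singleton hx0] at this
      omega

/-- A space spanned by two subspaces has a basis with prescribed numbers of vectors from each, as
far as the dimensions allow. -/
theorem exists_adapted_basis [FiniteDimensional ℂ V] {A B : Submodule ℂ V} (h : A ⊔ B = ⊤) {p q : ℕ}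
    (hp : p ≤ Module.finrank ℂ A) (hq : q ≤ Module.finrank ℂ B)
    (hpq : p + q = Module.finrank ℂ V) :
    ∃ (a : Fin p → V) (b : Fin q → V), (∀ i, a i ∈ A) ∧ (∀ i, b i ∈ B) ∧
      LinearIndependent ℂ (Sum.elim a b) := by
  obtain ⟨C, hCA, hC⟩ := exists_isCompl_le_of_sup_eq_top (sup_comm A B ▸ h)
  have hCf := Submodule.finrank_add_eq_of_isCompl hC
  obtain ⟨A', hCA', hA'A, hA'⟩ := exists_le_le_finrank_eq hCA (p := p) (by omega) hp
  have hA'B : A' ⊔ B = ⊤ := by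
    rw [eq_top_iff, ← hC.sup_eq_top]
    exact sup_le le_sup_right (hCA'.trans le_sup_left)
  obtain ⟨D, hDB, hD⟩ := exists_isCompl_le_of_sup_eq_top hA'B
  have hDf := Submodule.finrank_add_eq_of_isCompl hD
  obtain ⟨a⟩ : Nonempty (Module.Basis (Fin p) ℂ A') := ⟨Module.finBasisOfFinrankEq ℂ A' hA'⟩
  obtain ⟨b⟩ : Nonempty (Module.Basis (Fin q) ℂ D) :=
    ⟨Module.finBasisOfFinrankEq ℂ D (by omega)⟩
  refine ⟨fun i => a i, fun i => b i, fun i => hA'A (a i).2, fun i => hDB (b i).2, ?_⟩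
  refine LinearIndependent.sum_type (a.linearIndependent.map' _ A'.ker_subtype)
    (b.linearIndependent.map' _ D.ker_subtype) ?_
  refine hD.disjoint.mono ?_ ?_
  · exact Submodule.span_le.2 (by rintro _ ⟨i, rfl⟩; exact (a i).2)
  · exact Submodule.span_le.2 (by rintro _ ⟨i, rfl⟩; exact (b i).2)

theorem exists_basis_with_first [FiniteDimensional ℂ V] {c : V} (hc : c ≠ 0) {n : ℕ}
    (hn : Module.finrank ℂ V = n + 1) :
    ∃ e : Fin n → V, LinearIndependent ℂ (Sum.elim (fun _ : Unit => c) e) := by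
  obtain ⟨D, hD⟩ := exists_isCompl (ℂ ∙ c)
  have hDf := Submodule.finrank_add_eq_of_isCompl hD
  rw [finrank_span_singleton hc] at hDf
  obtain ⟨b⟩ : Nonempty (Module.Basis (Fin n) ℂ D) :=
    ⟨Module.finBasisOfFinrankEq ℂ D (by omega)⟩
  refine ⟨fun i => b i, LinearIndependent.sum_type (LinearIndependent.of_subsingleton () hc)
    (b.linearIndependent.map' _ D.ker_subtype) (hD.disjoint.mono ?_ ?_)⟩
  · exact Submodule.span_mono (by rintro _ ⟨_, rfl⟩; rfl)
  · exact Submodule.span_le.2 (by rintro _ ⟨i, rfl⟩; exact (b i).2)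

theorem exists_adapted_family [FiniteDimensional ℂ V] {A : Fin 2 → Submodule ℂ V}
    (h : A 0 ⊔ A 1 = ⊤) {p : Fin 2 → ℕ} (hp : ∀ t, p t ≤ Module.finrank ℂ (A t))
    (hpq : p 0 + p 1 = Module.finrank ℂ V) :
    ∃ a : (t : Fin 2) → Fin (p t) → V, (∀ t i, a t i ∈ A t) ∧
      LinearIndependent ℂ fun s : (t : Fin 2) × Fin (p t) => a s.1 s.2 := by
  obtain ⟨a, b, ha, hb, hab⟩ := exists_adapted_basis h (hp 0) (hp 1) hpq
  refine ⟨fun | 0 => a | 1 => b, fun | 0 => ha | 1 => hb, ?_⟩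
  let f : (t : Fin 2) × Fin (p t) → Fin (p 0) ⊕ Fin (p 1) := fun
    | ⟨0, i⟩ => .inl i
    | ⟨1, i⟩ => .inr i
  have hf : Function.Injective f := by
    rintro ⟨s, i⟩ ⟨t, j⟩ h
    fin_cases s <;> fin_cases t <;> simp_all [f]
  convert hab.comp f hf using 1
  funext ⟨t, i⟩
  fin_cases t <;> rfl

/-- The version of `exists_adapted_family` in which the basis also contains a given vector of the
intersection of the two subspaces. -/
theorem exists_adapted_family_with [FiniteDimensional ℂ V] {A : Fin 2 → Submodule ℂ V}
    (h : A 0 ⊔ A 1 = ⊤) {p : Fin 2 → ℕ} (hp : ∀ t, p t + 1 ≤ Module.finrank ℂ (A t))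
    (hpq : p 0 + p 1 + 1 = Module.finrank ℂ V) {c : V} (hc0 : c ≠ 0) (hc : ∀ t, c ∈ A t) :
    ∃ a : (t : Fin 2) → Fin (p t) → V, (∀ t i, a t i ∈ A t) ∧
      LinearIndependent ℂ
        (Sum.elim (fun _ : Unit => c) fun s : (t : Fin 2) × Fin (p t) => a s.1 s.2) := by
  have hfr (t) : Module.finrank ℂ ((A t).map (ℂ ∙ c).mkQ) + 1 = Module.finrank ℂ (A t) := by
    have := ((ℂ ∙ c).mkQ.domRestrict (A t)).finrank_range_add_finrank_ker
    rw [LinearMap.range_domRestrict, LinearMap.ker_domRestrict, Submodule.ker_mkQ] at this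
    rw [← this, ← finrank_span_singleton (K := ℂ) hc0,
      (Submodule.comapSubtypeEquivOfLe ((Submodule.span_singleton_le_iff_mem c (A t)).2
        (hc t))).finrank_eq]
  have hq := Submodule.finrank_quotient_add_finrank (ℂ ∙ c)
  rw [finrank_span_singleton hc0] at hq
  obtain ⟨a, ha, hli⟩ := exists_adapted_family (A := fun t => (A t).map (ℂ ∙ c).mkQ) (p := p)
    (by rw [← Submodule.map_sup, h, Submodule.map_top, Submodule.range_mkQ])
    (fun t => by have := hp t; have := hfr t; omega) (by omega)
  -- Representatives in `A t` of the classes modulo `c`.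
  choose b hb hba using ha
  refine ⟨b, hb, ?_⟩
  have hmem : c ∈ ℂ ∙ c := Submodule.mem_span_singleton_self c
  refine LinearIndependent.sumElim_of_quotient (M' := ℂ ∙ c) (f := fun _ : Unit => ⟨c, hmem⟩)
    (LinearIndependent.of_subsingleton () (by simpa using hc0)) _ ?_
  simpa only [Function.comp_def, ← Submodule.mkQ_apply, hba] using hli

theorem linearIndependent_complex_phase {κ σ : Type*} {e : κ → V} (he : LinearIndependent ℂ e)
    {g : σ → V} (φ : σ → Bool × κ) (hφ : Function.Injective fun s => (φ s).2)
    (hg : ∀ s, g s = phase (φ s).1 • e (φ s).2) : LinearIndependent ℂ g := by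
  have h0 : ∀ b, phase b ≠ 0 := by rintro (_ | _) <;> simp
  convert (he.comp _ hφ).units_smul (fun s => Units.mk0 _ (h0 (φ s).1)) using 1
  funext s
  simp [hg, Units.smul_def]

end Adapted

/-! ### Zero-forcing precoders -/

section ZeroForcing

variable {M N : Fin 2 → ℕ} {H : Channel M N}

/-- The signals with which transmitter `t` can reach receiver `r` without being heard by the other
receiver. -/
def hidden (H : Channel M N) (r t : Fin 2) : Submodule ℂ (Fin (N r) → ℂ) :=
  (LinearMap.ker (H.mat (other r) t).mulVecLin).map (H.mat r t).mulVecLin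

theorem mem_hidden {r t : Fin 2} {a : Fin (N r) → ℂ} :
    a ∈ hidden H r t ↔ ∃ x, H.mat (other r) t *ᵥ x = 0 ∧ H.mat r t *ᵥ x = a := by
  simp [hidden]

theorem Generic.exists_pair (hH : Generic H) (r : Fin 2) {t : Fin 2} (ht : N 0 + N 1 ≤ M t)
    (a : Fin (N r) → ℂ) (b : Fin (N (other r)) → ℂ) :
    ∃ x, H.mat r t *ᵥ x = a ∧ H.mat (other r) t *ᵥ x = b := by
  fin_cases r
  · exact hH.exists_both t ht a b
  · obtain ⟨x, h1, h2⟩ := hH.exists_both t ht b a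
    exact ⟨x, h2, h1⟩

theorem Generic.eq_zero_of_pair (hH : Generic H) (r : Fin 2) {t : Fin 2} (ht : M t ≤ N 0 + N 1)
    {x : Fin (M t) → ℂ} (h : H.mat r t *ᵥ x = 0) (h' : H.mat (other r) t *ᵥ x = 0) : x = 0 := by
  fin_cases r
  · exact hH.eq_zero t ht x h h'
  · exact hH.eq_zero t ht x h' h

theorem Generic.hidden_eq_top (hH : Generic H) (r : Fin 2) {t : Fin 2} (ht : N 0 + N 1 ≤ M t) :
    hidden H r t = ⊤ := by
  refine eq_top_iff.2 fun a _ => mem_hidden.2 ?_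
  obtain ⟨x, h1, h2⟩ := hH.exists_pair r ht a 0
  exact ⟨x, h2, h1⟩

theorem Generic.le_finrank_hidden (hH : Generic H) {r t : Fin 2} {p : ℕ} (h1 : p ≤ N r)
    (h2 : p + N (other r) ≤ M t) : p ≤ Module.finrank ℂ (hidden H r t) := by
  rcases le_total (N 0 + N 1) (M t) with ht | ht
  · rwa [hH.hidden_eq_top r ht, finrank_top, Module.finrank_fin_fun]
  · have hk := (H.mat (other r) t).mulVecLin.finrank_range_add_finrank_ker
    have hr := Submodule.finrank_le (LinearMap.range (H.mat (other r) t).mulVecLin)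
    rw [Module.finrank_fin_fun] at hk hr
    have : Module.finrank ℂ (hidden H r t) =
        Module.finrank ℂ (LinearMap.ker (H.mat (other r) t).mulVecLin) := by
      rw [hidden, ← LinearMap.range_domRestrict]
      refine LinearMap.finrank_range_of_inj (LinearMap.ker_eq_bot.1 ?_)
      rw [LinearMap.ker_eq_bot']
      exact fun x hx => Subtype.ext (hH.eq_zero_of_pair r ht hx x.2)
    omega

theorem Generic.hidden_sup (hH : Generic H) (r : Fin 2) : hidden H r 0 ⊔ hidden H r 1 = ⊤ := by
  refine eq_top_iff.2 fun a _ => ?_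
  obtain ⟨x, y, h, hx, hy⟩ := hH.exists_crossed r a 0 0
  exact Submodule.mem_sup.2 ⟨_, mem_hidden.2 ⟨x, hx, rfl⟩, _, mem_hidden.2 ⟨y, hy, rfl⟩, h⟩

/-- Zero-forcing precoders that fill the real space of receiver `r`. When the numbers of streams
are odd, both transmitters use one common complex direction `c`, one of them with `c` and the other
with `j c`. -/
theorem Generic.exists_zeroForcing (hH : Generic H) (r : Fin 2) {Q : Fin 2 → ℕ}
    (hQ : Q 0 + Q 1 = 2 * N r) (hM : ∀ t, (Q t + 1) / 2 + N (other r) ≤ M t) :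
    ∃ (l₁ l₂ : Fin 2 → ℕ) (hle : ∀ t, l₂ t ≤ l₁ t)
      (x : (t : Fin 2) → Fin (l₁ t) → Fin (M t) → ℂ),
      (∀ t, l₁ t + l₂ t = Q t) ∧ (∀ t k, H.mat (other r) t *ᵥ x t k = 0) ∧
      (∀ t, LinearIndependent ℂ (x t)) ∧
      LinearIndependent ℝ fun s : (t : Fin 2) × (Fin (l₁ t) ⊕ Fin (l₂ t)) =>
        H.mat r s.1 *ᵥ
          Sum.elim (x s.1) (fun k => Complex.I • x s.1 (Fin.castLE (hle s.1) k)) s.2 := by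
  have hQ0 := hM 0
  have hQ1 := hM 1
  rcases Nat.even_or_odd' (Q 0) with ⟨p, hp | hp⟩
  · have hle : ∀ t, Q t / 2 ≤ N r := by rw [Fin.forall_fin_two]; omega
    have hev : ∀ t, Q t / 2 + Q t / 2 = Q t := by rw [Fin.forall_fin_two]; omega
    obtain ⟨a, ha, hli⟩ := exists_adapted_family (hH.hidden_sup r) (p := fun t => Q t / 2)
      (fun t => hH.le_finrank_hidden (hle t) (by have := hM t; omega))
      (by rw [Module.finrank_fin_fun]; omega)
    choose x hx0 hxa using fun t i => mem_hidden.1 (ha t i)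
    refine ⟨_, _, fun t => le_rfl, x, hev, hx0, fun t => ?_, ?_⟩
    · refine LinearIndependent.of_comp (H.mat r t).mulVecLin ?_
      rw [show (H.mat r t).mulVecLin ∘ x t = a t from funext (hxa t)]
      exact hli.comp (fun i : Fin (Q t / 2) => (⟨t, i⟩ : (t : Fin 2) × Fin (Q t / 2)))
        fun i j h => by simpa using h
    · refine linearIndependent_phase hli
        (fun s => Sum.elim (fun k => (false, ⟨s.1, k⟩)) (fun k => (true, ⟨s.1, k⟩)) s.2) ?_ ?_
      · rintro ⟨s, i | i⟩ ⟨t, j | j⟩ h <;> simp at h ⊢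
        · obtain ⟨rfl, h⟩ := h; simpa using h
        · obtain ⟨rfl, h⟩ := h; simpa using h
      · rintro ⟨t, i | i⟩
        · simp [hxa]
        · simp [Matrix.mulVec_smul, hxa]
  · have hle : ∀ t, Q t / 2 + 1 ≤ N r := by rw [Fin.forall_fin_two]; omega
    have hod : ∀ t, Q t / 2 + 1 + Q t / 2 = Q t := by rw [Fin.forall_fin_two]; omega
    have hfr : ∀ t, Q t / 2 + 1 ≤ Module.finrank ℂ (hidden H r t) := fun t =>
      hH.le_finrank_hidden (hle t) (by have := hM t; have := hod t; omega)
    -- The two subspaces meet since their dimensions exceed `N r` together.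
    have hinf := Submodule.finrank_sup_add_finrank_inf_eq (hidden H r 0) (hidden H r 1)
    rw [hH.hidden_sup r, finrank_top, Module.finrank_fin_fun] at hinf
    have hne : hidden H r 0 ⊓ hidden H r 1 ≠ ⊥ := fun h => by
      rw [h, finrank_bot] at hinf
      have := hfr 0
      have := hfr 1
      omega
    obtain ⟨c, hcm, hc0⟩ := Submodule.exists_mem_ne_zero_of_ne_bot hne
    have hc : ∀ t, c ∈ hidden H r t := Fin.forall_fin_two.2 hcm
    obtain ⟨a, ha, hli⟩ := exists_adapted_family_with (hH.hidden_sup r) (p := fun t => Q t / 2)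
      hfr (by rw [Module.finrank_fin_fun]; omega) hc0 hc
    -- The last vector of each transmitter has no partner in the second block.
    let φ : (t : Fin 2) → Fin (Q t / 2 + 1) → Bool × (Unit ⊕ (t : Fin 2) × Fin (Q t / 2)) :=
      fun t => Fin.lastCases (decide (t = 1), .inl ()) fun i => (false, .inr ⟨t, i⟩)
    let e := Sum.elim (fun _ : Unit => c) fun s : (t : Fin 2) × Fin (Q t / 2) => a s.1 s.2
    have hx : ∀ t i, phase (φ t i).1 • e (φ t i).2 ∈ hidden H r t := by
      intro t i
      refine Submodule.smul_mem _ _ ?_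
      refine Fin.lastCases ?_ (fun i => ?_) i
      · simpa [φ, e] using hc t
      · simpa [φ, e] using ha t i
    choose x hx0 hxa using fun t i => mem_hidden.1 (hx t i)
    refine ⟨fun t => Q t / 2 + 1, fun t => Q t / 2, fun t => Nat.le_succ _, x, hod, hx0,
      fun t => ?_, ?_⟩
    · refine LinearIndependent.of_comp (H.mat r t).mulVecLin ?_
      refine linearIndependent_complex_phase hli (φ t) ?_ fun i => hxa t i
      intro i j
      refine Fin.lastCases ?_ (fun i => ?_) i <;> refine Fin.lastCases ?_ (fun j => ?_) j <;>
        simp [φ]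
    · refine linearIndependent_phase hli
        (fun s => Sum.elim (φ s.1) (fun k => (true, .inr ⟨s.1, k⟩)) s.2) ?_ ?_
      · rintro ⟨s, i | i⟩ ⟨t, j | j⟩
        · refine Fin.lastCases ?_ (fun i => ?_) i <;> refine Fin.lastCases ?_ (fun j => ?_) j
          · simp only [φ, Sum.elim_inl, Fin.lastCases_last, Prod.mk.injEq, and_true]
            intro h
            have : s = t := by
              clear * - h
              revert s t
              decide
            subst this
            rfl
          · simp [φ]
          · simp [φ]
          · simp only [φ, Sum.elim_inl, Fin.lastCases_castSucc, Prod.mk.injEq, true_and,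
              Sum.inr.injEq, Sigma.mk.injEq]
            rintro ⟨rfl, h⟩
            simpa using h
        · refine Fin.lastCases ?_ (fun i => ?_) i <;> simp [φ]
        · refine Fin.lastCases ?_ (fun j => ?_) j <;> simp [φ]
        · simp only [Sum.elim_inr, Prod.mk.injEq, true_and, Sum.inr.injEq, Sigma.mk.injEq]
          rintro ⟨rfl, h⟩
          simpa using h
      · rintro ⟨t, i | i⟩
        · simp [hxa, e]
        · have := hxa t i.castSucc
          simp only [φ, e, Fin.lastCases_castSucc, phase_false, one_smul, Sum.elim_inr] at this
          simp only [Sum.elim_inr, Matrix.mulVec_smul, phase_true]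
          exact congrArg _ this

end ZeroForcing

/-! ### Schemes on generic channels -/

section Schemes

variable {M N : Fin 2 → ℕ} {H : Channel M N}

/-- With few enough streams for the null spaces no alignment is needed. -/
theorem Generic.exists_scheme_zeroForcing (hH : Generic H) {Q : Fin 2 → Fin 2 → ℕ}
    (hpos : ∀ r t, 1 ≤ Q r t) (hQ : ∀ r, Q r 0 + Q r 1 = 2 * N r)
    (hM : ∀ r t, (Q r t + 1) / 2 + N (other r) ≤ M t) :
    ∃ P : Precoding M, IsScheme H P ∧ P.Q = Q := by
  choose l₁ l₂ hle x hl hx0 hxi hsep using fun r => hH.exists_zeroForcing r (hQ r) (hM r)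
  let P : Precoding M :=
    { len₁ := l₁
      len₂ := l₂
      len₃ := fun _ _ => 0
      v := x
      w := fun r t k => Complex.I • x r t (Fin.castLE (hle r t) k)
      u := fun _ _ => Fin.elim0 }
  have hPQ : P.Q = Q := by
    funext r t
    simp [Precoding.Q, P, hl]
  refine ⟨P, ⟨fun r t => ?_, hxi, hx0, hle, fun r t k => rfl, fun r => ?_, fun r => rfl,
    fun r k => k.elim0, fun r => ?_⟩, hPQ⟩
  · rw [hPQ]
    exact hpos r t
  · have : IsEmpty (Fin (P.len₃ r 0)) := inferInstanceAs (IsEmpty (Fin 0))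
    exact linearIndependent_empty_type
  · let f : ((t : Fin 2) × P.Stream r t) ⊕ Fin (P.len₃ (other r) 0) →
        (t : Fin 2) × (Fin (l₁ r t) ⊕ Fin (l₂ r t)) := fun
      | .inl ⟨t, .inl k⟩ => ⟨t, .inl k⟩
      | .inl ⟨t, .inr (.inl k)⟩ => ⟨t, .inr k⟩
      | .inl ⟨t, .inr (.inr k)⟩ => k.elim0
      | .inr k => k.elim0
    have hf : Function.Injective f := by
      rintro (⟨s, i | i | i⟩ | i) (⟨t, j | j | j⟩ | j) h
      all_goals first | exact i.elim0 | exact j.elim0 | skip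
      all_goals
        simp only [f, Sigma.mk.injEq] at h
        obtain ⟨rfl, h⟩ := h
        simp at h
      · rw [h]
      · rw [h]
    convert (hsep r).comp f hf using 1
    funext s
    rcases s with (⟨s, i | i | i⟩ | i)
    · rfl
    · rfl
    · exact i.elim0
    · exact i.elim0

theorem Generic.surjective_one (hH : Generic H) (r : Fin 2) :
    Function.Surjective (H.mat r 1).mulVec := by
  intro c
  fin_cases r
  · obtain ⟨x, y, -, -, h⟩ := hH.exists_crossed 1 0 0 c
    exact ⟨y, h⟩
  · obtain ⟨x, y, -, -, h⟩ := hH.exists_crossed 0 0 0 c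
    exact ⟨y, h⟩

theorem Generic.injective_one (hH : Generic H) {r : Fin 2} (h : M 1 = N r) :
    Function.Injective (H.mat r 1).mulVec := by
  have : Module.finrank ℂ (Fin (M 1) → ℂ) = Module.finrank ℂ (Fin (N r) → ℂ) := by simp [h]
  exact (LinearMap.injective_iff_surjective_of_finrank_eq_finrank
    (f := (H.mat r 1).mulVecLin) this).2 (hH.surjective_one r)

/-- When transmitter `1` and both receivers have the same number of antennas, transmitter `1` can
hide nothing. It sends `x` and `j x`, one to each receiver, and transmitter `0`, which can prescribe
the signals at both receivers, aligns with the one that is not desired. -/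
theorem Generic.exists_scheme_square (hH : Generic H) {n : ℕ} (hN : ∀ r, N r = n + 2)
    (hM1 : M 1 = n + 2) (hM0 : N 0 + N 1 ≤ M 0) :
    ∃ P : Precoding M, IsScheme H P ∧ ∀ r, P.Q r 0 = 2 * n + 2 ∧ P.Q r 1 = 1 := by
  let x : Fin (M 1) → ℂ := fun _ => 1
  have hx : x ≠ 0 := fun h => one_ne_zero (congrFun h ⟨0, by omega⟩)
  have hinj (r) := hH.injective_one (r := r) (by rw [hN, hM1])
  have hc (r) : H.mat r 1 *ᵥ x ≠ 0 := fun h => hx (hinj r (by simpa using h))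
  choose e he using fun r => exists_basis_with_first (hc r) (n := n + 1)
    (by rw [Module.finrank_fin_fun, hN])
  choose v hv hv0 using fun r k => hH.exists_pair r hM0 (e r k) 0
  -- At the receiver where it is desired, `u r` fills the direction that the shorter second block
  -- leaves free; at the other one it is aligned with the stream of transmitter `1`.
  choose u hu hu' using fun r => hH.exists_pair r hM0 (Complex.I • e r (Fin.last n))
    (H.mat (other r) 1 *ᵥ (phase (decide (r = 1)) • x))
  have hu'' (r) : H.mat r 0 *ᵥ u (other r) = phase (decide (other r = 1)) • H.mat r 1 *ᵥ x := by
    rw [← Matrix.mulVec_smul]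
    fin_cases r
    · exact hu' 1
    · exact hu' 0
  have h0 : ∀ r : Fin 2, phase (decide (r = 1)) ≠ 0 := by intro r; fin_cases r <;> simp
  let P : Precoding M :=
    { len₁ := fun _ => fun | 0 => n + 1 | 1 => 0
      len₂ := fun _ => fun | 0 => n | 1 => 0
      len₃ := fun _ _ => 1
      v := fun r => fun | 0 => v r | 1 => Fin.elim0
      w := fun r => fun | 0 => fun k => Complex.I • v r k.castSucc | 1 => Fin.elim0
      u := fun r => fun | 0 => fun _ => u r | 1 => fun _ => phase (decide (r = 1)) • x }
  refine ⟨P, ⟨?_, ?_, ?_, ?_, ?_, fun r => ?_, fun r => rfl, fun r k => ?_, fun r => ?_⟩, ?_⟩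
  · intro r t
    simp [Precoding.Q, P]
  · intro r t
    fin_cases t
    · refine LinearIndependent.of_comp (H.mat r 0).mulVecLin ?_
      rw [show (H.mat r 0).mulVecLin ∘ _ = e r from funext (hv r)]
      exact (he r).comp Sum.inr Sum.inr_injective
    · exact linearIndependent_empty_type (ι := Fin 0)
  · intro r t k
    fin_cases t
    · exact hv0 r k
    · exact k.elim0
  · intro r t
    fin_cases t <;> simp [P]
  · intro r t k
    fin_cases t
    · rfl
    · exact k.elim0
  · refine LinearIndependent.of_subsingleton (ι := Fin 1) 0 ?_
    change H.mat (other r) 0 *ᵥ u r ≠ 0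
    rw [hu', Matrix.mulVec_smul]
    exact smul_ne_zero (h0 r) (hc _)
  · exact congrArg (fun z => Submodule.span ℝ {z}) (hu' r).symm
  · let φ : ((t : Fin 2) × P.Stream r t) ⊕ Fin (P.len₃ (other r) 0) →
        Bool × (Unit ⊕ Fin (n + 1)) := fun
      | .inl ⟨0, .inl k⟩ => (false, .inr k)
      | .inl ⟨0, .inr (.inl k)⟩ => (true, .inr (Fin.castSucc k))
      | .inl ⟨0, .inr (.inr _)⟩ => (true, .inr (Fin.last n))
      | .inl ⟨1, .inl k⟩ => k.elim0
      | .inl ⟨1, .inr (.inl k)⟩ => k.elim0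
      | .inl ⟨1, .inr (.inr _)⟩ => (decide (r = 1), .inl ())
      | .inr _ => (decide (other r = 1), .inl ())
    refine linearIndependent_phase (he r) φ ?_ ?_
    · have h1 (k : Fin (P.len₃ r 0)) (l : Fin (P.len₃ r 0)) : k = l :=
        Subsingleton.elim (α := Fin 1) k l
      have h2 (k : Fin n) : Fin.castSucc k ≠ Fin.last n := (Fin.castSucc_lt_last k).ne
      have h4 : (decide (r = 1) = decide (other r = 1)) = False := by
        clear * -; revert r; decide
      rintro (⟨s, i | i | i⟩ | i) (⟨t, j | j | j⟩ | j) h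
      all_goals first | fin_cases s | skip
      all_goals first | fin_cases t | skip
      all_goals first | exact i.elim0 | exact j.elim0 | skip
      all_goals simp [φ, h2, h4, Ne.symm, eq_comm] at h
      all_goals first | (subst h; rfl) | skip
      · rw [h1 i j]
      · rw [h1 i j]
      · rw [Subsingleton.elim (α := Fin 1) i j]
    · rintro (⟨s, i | i | i⟩ | i)
      all_goals first | fin_cases s | skip
      · exact (hv r i).trans (one_smul _ _).symm
      · exact i.elim0
      · exact (Matrix.mulVec_smul _ _ _).trans (congrArg _ (hv r _))
      · exact i.elim0
      · exact hu r
      · exact Matrix.mulVec_smul _ _ _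
      · exact hu'' r
  · exact fun r => ⟨by simp [Precoding.Q, P]; omega, by simp [Precoding.Q, P]⟩

theorem exists_basis_extending {V : Type*} [AddCommGroup V] [Module ℂ V] [FiniteDimensional ℂ V]
    {B : Submodule ℂ V} {c : V} (hc : c ∉ B) {q n : ℕ} (hq : q ≤ Module.finrank ℂ B)
    (hn : q + 1 + n = Module.finrank ℂ V) :
    ∃ (b : Fin q → V) (e : Fin n → V), (∀ i, b i ∈ B) ∧
      LinearIndependent ℂ (Sum.elim (Sum.elim b fun _ : Unit => c) e) := by
  obtain ⟨B', -, hB', hq'⟩ := exists_le_le_finrank_eq (bot_le (a := B)) (by simp) hq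
  obtain ⟨b⟩ : Nonempty (Module.Basis (Fin q) ℂ B') := ⟨Module.finBasisOfFinrankEq ℂ B' hq'⟩
  have hc0 : c ≠ 0 := fun h => hc (h ▸ B.zero_mem)
  have hd : Disjoint B' (ℂ ∙ c) :=
    (Submodule.disjoint_span_singleton' hc0).2 fun h => hc (hB' h)
  obtain ⟨D, hD⟩ := exists_isCompl (B' ⊔ ℂ ∙ c)
  have h1 := Submodule.finrank_sup_add_finrank_inf_eq B' (ℂ ∙ c)
  rw [hd.eq_bot, finrank_bot, finrank_span_singleton hc0] at h1
  have h2 := Submodule.finrank_add_eq_of_isCompl hD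
  obtain ⟨e⟩ : Nonempty (Module.Basis (Fin n) ℂ D) :=
    ⟨Module.finBasisOfFinrankEq ℂ D (by omega)⟩
  refine ⟨fun i => b i, fun i => e i, fun i => hB' (b i).2, LinearIndependent.sum_type
    (LinearIndependent.sum_type (b.linearIndependent.map' _ B'.ker_subtype)
      (LinearIndependent.of_subsingleton () hc0) (hd.mono ?_ ?_))
    (e.linearIndependent.map' _ D.ker_subtype) (hD.disjoint.mono ?_ ?_)⟩
  · exact Submodule.span_le.2 (by rintro _ ⟨i, rfl⟩; exact (b i).2)
  · exact Submodule.span_mono (by rintro _ ⟨_, rfl⟩; rfl)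
  · refine Submodule.span_le.2 ?_
    rintro _ ⟨i | i, rfl⟩
    · exact Submodule.mem_sup_left (b i).2
    · exact Submodule.mem_sup_right (Submodule.mem_span_singleton_self c)
  · exact Submodule.span_le.2 (by rintro _ ⟨i, rfl⟩; exact (e i).2)

theorem injective_sigma_sum {S : Fin 2 → Type*} {I K : Type*} {φ : (t : Fin 2) → S t → K}
    {φi : I → K} (h0 : Function.Injective (φ 0)) (h1 : Function.Injective (φ 1))
    (h01 : ∀ a b, φ 0 a ≠ φ 1 b) (hi : Function.Injective φi) (h0i : ∀ a b, φ 0 a ≠ φi b)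
    (h1i : ∀ a b, φ 1 a ≠ φi b) :
    Function.Injective (Sum.elim (fun s : (t : Fin 2) × S t => φ s.1 s.2) φi) := by
  refine Function.Injective.sumElim ?_ hi ?_
  · rintro ⟨s, a⟩ ⟨t, b⟩ h
    fin_cases s <;> fin_cases t
    · exact congrArg _ (h0 h)
    · exact (h01 _ _ h).elim
    · exact (h01 _ _ h.symm).elim
    · exact congrArg _ (h1 h)
  · rintro ⟨s, a⟩ b
    fin_cases s
    · exact h0i a b
    · exact h1i a b

/-- When transmitter `1` has as many antennas as receiver `0`, it can hide nothing from that
receiver. Its only stream for receiver `1` is heard by receiver `0` along `c`, with which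
transmitter `0` aligns one stream; the direction `j c` that remains carries a desired stream. -/
theorem Generic.exists_scheme_unequal (hH : Generic H) {n q : ℕ} (hN1 : N 1 = n + 1)
    (hN0 : N 0 = n + 1 + q) (hq : 1 ≤ q) (hM1 : M 1 = N 0) (hM0 : N 0 + N 1 ≤ M 0) :
    ∃ P : Precoding M, IsScheme H P ∧ P.Q 0 0 = 2 * n + 1 ∧ P.Q 1 0 = 2 * n + 1 ∧
      P.Q 0 1 = 2 * q ∧ P.Q 1 1 = 1 := by
  obtain ⟨y, hy⟩ := hH.surjective_one 1 (fun _ => 1)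
  have hy : H.mat 1 1 *ᵥ y ≠ 0 := fun h => one_ne_zero (congrFun (hy.symm.trans h) ⟨0, by omega⟩)
  have hinj := hH.injective_one hM1
  have hc : H.mat 0 1 *ᵥ y ∉ hidden H 0 1 := fun h => by
    obtain ⟨z, hz0, hz⟩ := mem_hidden.1 h
    exact hy (hinj hz ▸ hz0)
  have hN1' : N (other 0) = n + 1 := hN1
  obtain ⟨b, e, hb, hbe⟩ := exists_basis_extending hc (q := q) (n := n)
    (hH.le_finrank_hidden (by omega) (by omega)) (by rw [Module.finrank_fin_fun]; omega)
  obtain ⟨f, hf⟩ := exists_basis_with_first hy (n := n) (by rw [Module.finrank_fin_fun, hN1])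
  choose v₀₁ hv₀₁' hv₀₁ using fun i => mem_hidden.1 (hb i)
  -- The unpaired last vector of transmitter `0` takes the direction `j c`.
  let ψ : Fin (n + 1) → Bool × ((Fin q ⊕ Unit) ⊕ Fin n) :=
    Fin.lastCases (true, .inl (.inr ())) fun i => (false, .inr i)
  let E := Sum.elim (Sum.elim b fun _ : Unit => H.mat 0 1 *ᵥ y) e
  choose v₀₀ hv₀₀ hv₀₀' using fun k =>
    hH.exists_pair 0 hM0 (phase (ψ k).1 • E (ψ k).2) 0
  choose v₁₀ hv₁₀ hv₁₀' using fun k => hH.exists_pair 1 hM0 (f k) 0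
  obtain ⟨u, hu, hu'⟩ := hH.exists_both 0 hM0 (H.mat 0 1 *ᵥ y) (Complex.I • H.mat 1 1 *ᵥ y)
  have hψ : ∀ k, (∃ i : Fin n, ψ k = (false, .inr i)) ∨ ψ k = (true, .inl (.inr ())) :=
    Fin.lastCases (by simp [ψ]) (by simp [ψ])
  have hψi : Function.Injective ψ := by
    intro i j
    refine Fin.lastCases ?_ (fun i => ?_) i <;> refine Fin.lastCases ?_ (fun j => ?_) j <;>
      simp [ψ]
  have hψE (i : Fin n) : phase (ψ i.castSucc).1 • E (ψ i.castSucc).2 = e i := by simp [ψ, E]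
  let P : Precoding M :=
    { len₁ := fun | 0 => fun | 0 => n + 1 | 1 => q
                  | 1 => fun | 0 => n | 1 => 0
      len₂ := fun | 0 => fun | 0 => n | 1 => q
                  | 1 => fun | 0 => n | 1 => 0
      len₃ := fun | 0 => fun _ => 0 | 1 => fun _ => 1
      v := fun | 0 => fun | 0 => v₀₀ | 1 => v₀₁
               | 1 => fun | 0 => v₁₀ | 1 => Fin.elim0
      w := fun | 0 => fun | 0 => fun k => Complex.I • v₀₀ k.castSucc
                          | 1 => fun k => Complex.I • v₀₁ k
               | 1 => fun | 0 => fun k => Complex.I • v₁₀ k | 1 => Fin.elim0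
      u := fun | 0 => fun _ => Fin.elim0
               | 1 => fun | 0 => fun _ => u | 1 => fun _ => y }
  let φ : (t : Fin 2) → P.Stream 0 t → Bool × ((Fin q ⊕ Unit) ⊕ Fin n) := fun
    | 0 => Sum.elim ψ (Sum.elim (fun k : Fin n => (true, .inr k)) Fin.elim0)
    | 1 => Sum.elim (fun k : Fin q => (false, .inl (.inl k)))
      (Sum.elim (fun k : Fin q => (true, .inl (.inl k))) Fin.elim0)
  let χ : (t : Fin 2) → P.Stream 1 t → Bool × (Unit ⊕ Fin n) := fun
    | 0 => Sum.elim (fun k : Fin n => (false, .inr k))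
      (Sum.elim (fun k : Fin n => (true, .inr k)) (fun _ : Fin 1 => (true, .inl ())))
    | 1 => Sum.elim Fin.elim0 (Sum.elim Fin.elim0 (fun _ : Fin 1 => (false, .inl ())))
  refine ⟨P, ⟨?_, ?_, ?_, ?_, ?_, ?_, ?_, ?_, ?_⟩, ?_, ?_, ?_, ?_⟩
  · simp only [Fin.forall_fin_two, Precoding.Q, P]
    omega
  · simp only [Fin.forall_fin_two]
    refine ⟨⟨?_, ?_⟩, ?_, ?_⟩
    · refine LinearIndependent.of_comp (H.mat 0 0).mulVecLin ?_
      refine linearIndependent_complex_phase hbe ψ ?_ hv₀₀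
      intro i j
      refine Fin.lastCases ?_ (fun i => ?_) i <;> refine Fin.lastCases ?_ (fun j => ?_) j <;>
        simp [ψ]
    · refine LinearIndependent.of_comp (H.mat 0 1).mulVecLin ?_
      rw [show (H.mat 0 1).mulVecLin ∘ _ = b from funext hv₀₁]
      exact (hbe.comp _ Sum.inl_injective).comp _ Sum.inl_injective
    · refine LinearIndependent.of_comp (H.mat 1 0).mulVecLin ?_
      rw [show (H.mat 1 0).mulVecLin ∘ _ = f from funext hv₁₀]
      exact hf.comp _ Sum.inr_injective
    · exact linearIndependent_empty_type (ι := Fin 0)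
  · simp only [Fin.forall_fin_two]
    exact ⟨⟨hv₀₀', hv₀₁'⟩, hv₁₀', fun k => k.elim0⟩
  · simp [Fin.forall_fin_two, P]
  · simp only [Fin.forall_fin_two]
    exact ⟨⟨fun _ => rfl, fun _ => rfl⟩, fun _ => rfl, fun k => k.elim0⟩
  · simp only [Fin.forall_fin_two]
    refine ⟨linearIndependent_empty_type (ι := Fin 0),
      LinearIndependent.of_subsingleton (ι := Fin 1) 0 ?_⟩
    change H.mat 0 0 *ᵥ u ≠ 0
    rw [hu]
    exact fun h => hc (h ▸ Submodule.zero_mem _)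
  · simp only [Fin.forall_fin_two]
    exact ⟨rfl, rfl⟩
  · simp only [Fin.forall_fin_two]
    exact ⟨fun k => k.elim0, fun _ => congrArg (fun z => Submodule.span ℝ {z}) hu.symm⟩
  · simp only [Fin.forall_fin_two]
    constructor
    · refine linearIndependent_phase hbe (Sum.elim (fun s : (t : Fin 2) × P.Stream 0 t => φ s.1 s.2)
        fun _ : Fin 1 => (false, .inl (.inr ()))) (injective_sigma_sum ?_ ?_ ?_ ?_ ?_ ?_) ?_
      · refine Function.Injective.sumElim hψi
          (Function.Injective.sumElim (fun i j h => by simpa using h) (fun i => i.elim0)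
            fun _ k => k.elim0) fun i j => ?_
        rcases j with j | j
        · rcases hψ i with ⟨i', hi⟩ | hi <;> rw [hi] <;> simp
        · exact j.elim0
      · exact Function.Injective.sumElim (fun i j h => by simpa using h)
          (Function.Injective.sumElim (fun i j h => by simpa using h) (fun i => i.elim0)
            fun _ k => k.elim0) fun i j => by
            rcases j with j | j
            · simp
            · exact j.elim0
      · rintro (i | i | i) (j | j | j)
        all_goals first | exact i.elim0 | exact j.elim0 | skip
        all_goals simp only [φ, Sum.elim_inl, Sum.elim_inr]
        · rcases hψ i with ⟨i', hi⟩ | hi <;> rw [hi] <;> simp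
        · rcases hψ i with ⟨i', hi⟩ | hi <;> rw [hi] <;> simp
        · simp
        · simp
      · exact Function.injective_of_subsingleton (α := Fin 1) _
      · rintro (i | i | i) _
        · simp only [φ, Sum.elim_inl]
          rcases hψ i with ⟨i', hi⟩ | hi <;> rw [hi] <;> simp
        · simp [φ]
        · exact i.elim0
      · rintro (i | i | i) _
        · simp [φ]
        · simp [φ]
        · exact i.elim0
      · rintro (⟨s, i | i | i⟩ | i)
        all_goals first | fin_cases s | skip
        · exact hv₀₀ i
        · exact (hv₀₁ i).trans (one_smul _ _).symm
        · exact (Matrix.mulVec_smul _ _ _).trans (congrArg _ ((hv₀₀ _).trans (hψE i)))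
        · exact (Matrix.mulVec_smul _ _ _).trans (congrArg _ (hv₀₁ i))
        · exact i.elim0
        · exact i.elim0
        · exact hu.trans (one_smul _ _).symm
    · refine linearIndependent_phase hf (Sum.elim (fun s : (t : Fin 2) × P.Stream 1 t => χ s.1 s.2)
        Fin.elim0) (injective_sigma_sum ?_ ?_ ?_ (fun i => i.elim0) (fun _ i => i.elim0)
          fun _ i => i.elim0) ?_
      · refine Function.Injective.sumElim (fun i j h => by simpa using h)
          (Function.Injective.sumElim (fun i j h => by simpa using h)
            (Function.injective_of_subsingleton (α := Fin 1) _) ?_) ?_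
        · simp
        · exact fun i => Sum.rec (by simp) (by simp)
      · exact Function.Injective.sumElim (fun i => i.elim0)
          (Function.Injective.sumElim (fun i => i.elim0)
            (Function.injective_of_subsingleton (α := Fin 1) _) fun i => i.elim0) fun i => i.elim0
      · rintro (i | i | i) (j | j | j)
        all_goals first | exact j.elim0 | simp [χ]
      · rintro (⟨s, i | i | i⟩ | i)
        all_goals first | fin_cases s | skip
        · exact (hv₁₀ i).trans (one_smul _ _).symm
        · exact i.elim0
        · exact (Matrix.mulVec_smul _ _ _).trans (congrArg _ (hv₁₀ i))
        · exact i.elim0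
        · exact hu'
        · exact (one_smul _ _).symm
        · exact i.elim0
  · simp only [Precoding.Q, P]; omega
  · simp only [Precoding.Q, P]; omega
  · simp only [Precoding.Q, P]; omega
  · simp only [Precoding.Q, P]

end Schemes

/-! ### The dimension bound on schemes -/

section Bound

variable {M N : Fin 2 → ℕ} {H : Channel M N} {P : Precoding M}

theorem IsScheme.card_le (h : IsScheme H P) (r : Fin 2) :
    P.Q r 0 + P.Q r 1 + P.len₃ (other r) 0 ≤ 2 * N r := by
  have := (h.separable r).fintype_card_le_finrank
  simp only [Fintype.card_sum, Fintype.card_sigma, Fin.sum_univ_two, Fintype.card_fin] at this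
  have hf : Module.finrank ℝ (Fin (N r) → ℂ) = 2 * N r := by
    rw [Module.finrank_pi_fintype]
    simp [Complex.finrank_real_complex, mul_comm]
  simp only [Precoding.Q]
  omega

/-- Without a null space to zero-force in, the third block of transmitter `1` is needed. -/
theorem IsScheme.one_le_len₃ (h : IsScheme H P) {r : Fin 2}
    (hinj : Function.Injective (H.mat (other r) 1).mulVec) : 1 ≤ P.len₃ r 0 := by
  have h1 : P.len₁ r 1 = 0 := by
    by_contra h0
    have k : Fin (P.len₁ r 1) := ⟨0, Nat.pos_of_ne_zero h0⟩
    refine (h.v_indep r 1).ne_zero k (hinj ?_)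
    rw [h.v_null, Matrix.mulVec_zero]
  have h2 := h.len₂_le r 1
  have h3 := h.active r 1
  have h4 := h.len₃_eq r
  simp only [Precoding.Q] at h3
  omega

theorem Precoding.dof_eq (P : Precoding M) :
    P.dof = ((P.Q 0 0 + P.Q 0 1 + (P.Q 1 0 + P.Q 1 1) : ℕ) : ℝ) / 2 := by
  simp [Precoding.dof, Fin.sum_univ_two]

theorem IsScheme.dof_le (h : IsScheme H P) :
    P.dof ≤ N 0 + N 1 - ((P.len₃ 0 0 + P.len₃ 1 0 : ℕ) : ℝ) / 2 := by
  have h0 : P.Q 0 0 + P.Q 0 1 + P.len₃ 1 0 ≤ 2 * N 0 := h.card_le 0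
  have h1 : P.Q 1 0 + P.Q 1 1 + P.len₃ 0 0 ≤ 2 * N 1 := h.card_le 1
  have : ((P.Q 0 0 + P.Q 0 1 + (P.Q 1 0 + P.Q 1 1) + (P.len₃ 0 0 + P.len₃ 1 0) : ℕ) : ℝ) ≤
      (2 * N 0 + 2 * N 1 : ℕ) := by
    exact_mod_cast (by omega)
  rw [P.dof_eq]
  push_cast at this ⊢
  linarith

end Bound

/-! ### Codes with large minimum distance -/

section Hamming

theorem card_hammingBall_le {n L : ℕ} (hL : 1 ≤ L) (x : Fin n → Fin L) (d : ℕ) :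
    (Finset.univ.filter fun y => hammingDist x y ≤ d).card ≤ 2 ^ n * L ^ d := by
  classical
  let F : Finset (Fin n) → Finset (Fin n → Fin L) :=
    fun S => Fintype.piFinset fun i => if i ∈ S then Finset.univ else {x i}
  have hsub : (Finset.univ.filter fun y => hammingDist x y ≤ d) ⊆
      (Finset.univ.filter fun S : Finset (Fin n) => S.card ≤ d).biUnion F := by
    intro y hy
    simp only [Finset.mem_filter, Finset.mem_univ, true_and] at hy
    simp only [Finset.mem_biUnion, Finset.mem_filter, Finset.mem_univ, true_and, F,
      Fintype.mem_piFinset]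
    refine ⟨Finset.univ.filter fun i => x i ≠ y i, hy, fun i => ?_⟩
    by_cases h : x i = y i <;> simp [h]
  have hF : ∀ S : Finset (Fin n), (F S).card = L ^ S.card := by
    intro S
    rw [Fintype.card_piFinset]
    simp only [apply_ite Finset.card, Finset.card_univ, Fintype.card_fin, Finset.card_singleton]
    rw [Finset.prod_ite_mem, Finset.univ_inter, Finset.prod_const]
  calc _ ≤ _ := Finset.card_le_card hsub
    _ ≤ ∑ S ∈ Finset.univ.filter (fun S : Finset (Fin n) => S.card ≤ d), (F S).card :=
      Finset.card_biUnion_le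
    _ ≤ ∑ S ∈ Finset.univ.filter (fun S : Finset (Fin n) => S.card ≤ d), L ^ d := by
      refine Finset.sum_le_sum fun S hS => ?_
      rw [hF]
      exact Nat.pow_le_pow_right hL (Finset.mem_filter.1 hS).2
    _ ≤ 2 ^ n * L ^ d := by
      rw [Finset.sum_const, smul_eq_mul]
      refine Nat.mul_le_mul_right _ ((Finset.card_filter_le _ _).trans ?_)
      simp

/-- The Gilbert–Varshamov bound: the balls of radius `d` around the words of a maximal code of
minimum distance greater than `d` cover the space. -/
theorem exists_code_hammingDist (n L d : ℕ) (hL : 1 ≤ L) :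
    ∃ (K : ℕ) (cw : Fin K → Fin n → Fin L), 1 ≤ K ∧ (∀ i j, hammingDist (cw i) (cw j) ≤ d → i = j) ∧
      L ^ n ≤ K * (2 ^ n * L ^ d) := by
  classical
  let good : Finset (Finset (Fin n → Fin L)) := Finset.univ.filter fun C =>
    ∀ x ∈ C, ∀ y ∈ C, hammingDist x y ≤ d → x = y
  obtain ⟨C, hC, hmax⟩ := good.exists_max_image Finset.card ⟨∅, by simp [good]⟩
  have hCg : ∀ x ∈ C, ∀ y ∈ C, hammingDist x y ≤ d → x = y := (Finset.mem_filter.1 hC).2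
  have hcov : ∀ y, ∃ x ∈ C, hammingDist x y ≤ d := by
    intro y
    by_contra! h
    have hy : y ∉ C := fun hy => by simpa using h y hy
    have := hmax (insert y C) <| Finset.mem_filter.2 ⟨Finset.mem_univ _, by
      intro a ha' b hb' hab
      rcases Finset.mem_insert.1 ha' with rfl | ha <;> rcases Finset.mem_insert.1 hb' with rfl | hb
      · rfl
      · rw [hammingDist_comm] at hab
        exact absurd hab (h b hb).not_ge
      · exact absurd hab (h a ha).not_ge
      · exact hCg a ha b hb hab⟩
    rw [Finset.card_insert_of_notMem hy] at this
    omega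
  refine ⟨C.card, fun i => (C.equivFin.symm i : Fin n → Fin L), ?_, fun i j h => ?_, ?_⟩
  · obtain ⟨x, hx, -⟩ := hcov fun _ => ⟨0, hL⟩
    exact Finset.card_pos.2 ⟨x, hx⟩
  · exact C.equivFin.symm.injective (Subtype.ext (hCg _ (Subtype.prop _) _ (Subtype.prop _) h))
  · calc L ^ n = (Finset.univ : Finset (Fin n → Fin L)).card := by simp
      _ ≤ (C.biUnion fun x => Finset.univ.filter fun y => hammingDist x y ≤ d).card := by
        refine Finset.card_le_card fun y _ => ?_
        obtain ⟨x, hx, hxy⟩ := hcov y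
        exact Finset.mem_biUnion.2 ⟨x, hx, by simpa using hxy⟩
      _ ≤ C.card * (2 ^ n * L ^ d) :=
        Finset.card_biUnion_le_card_mul _ _ _ fun x _ => card_hammingBall_le hL x d

/-- Decoding with fewer than `b` symbol errors, which may lead out of the alphabet. -/
theorem exists_decoder {n K L b : ℕ} (hK : 1 ≤ K) (cw : Fin K → Fin n → Fin L)
    (hcw : ∀ i j, hammingDist (cw i) (cw j) ≤ 2 * b → i = j) :
    ∃ D : (Fin n → ℤ) → Fin K, ∀ w i,
      (Finset.univ.filter fun τ => w τ ≠ ((cw i τ : ℕ) : ℤ)).card < b → D w = i := by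
  classical
  refine ⟨fun w => if h : ∃ i, (Finset.univ.filter fun τ => w τ ≠ ((cw i τ : ℕ) : ℤ)).card < b then
    h.choose else ⟨0, hK⟩, fun w i hi => ?_⟩
  have h : ∃ i, (Finset.univ.filter fun τ => w τ ≠ ((cw i τ : ℕ) : ℤ)).card < b := ⟨i, hi⟩
  beta_reduce
  rw [dif_pos h]
  refine hcw _ _ ?_
  have hsub : (Finset.univ.filter fun τ => cw h.choose τ ≠ cw i τ) ⊆
      (Finset.univ.filter fun τ => w τ ≠ ((cw h.choose τ : ℕ) : ℤ)) ∪
        Finset.univ.filter fun τ => w τ ≠ ((cw i τ : ℕ) : ℤ) := by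
    intro τ
    simp only [Finset.mem_union, Finset.mem_filter, Finset.mem_univ, true_and]
    intro hne
    by_contra! hcon
    exact hne (Fin.ext (by exact_mod_cast hcon.1.symm.trans hcon.2))
  calc _ ≤ _ := Finset.card_le_card hsub
    _ ≤ _ := Finset.card_union_le _ _
    _ ≤ 2 * b := by have := h.choose_spec; omega

end Hamming

/-! ### Symbol errors -/

section Noise

/-- With probability tending to one a real linear functional of the noise is small. -/
theorem exists_forall_measure_abs_le {V : Type*} [MeasurableSpace V] (ν : Measure V)
    [IsProbabilityMeasure ν] {ψ : V → ℝ} (hψ : Measurable ψ) {p : ℝ} (hp : 0 < p) :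
    ∃ a₀ : ℝ, ∀ a ≥ a₀, ν.real {x | a ≤ |ψ x|} ≤ p := by
  have h := tendsto_measure_iInter_atTop (μ := ν) (s := fun k : ℕ => {x | (k : ℝ) ≤ |ψ x|})
    (fun k => (measurableSet_le measurable_const hψ.abs).nullMeasurableSet)
    (fun i j hij x hx => le_trans (by exact_mod_cast hij) (show (j : ℝ) ≤ |ψ x| from hx))
    ⟨0, measure_ne_top _ _⟩
  have he : ⋂ k : ℕ, {x | (k : ℝ) ≤ |ψ x|} = ∅ := by
    ext x
    obtain ⟨k, hk⟩ := exists_nat_gt |ψ x|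
    simpa using ⟨k, hk⟩
  rw [he, measure_empty] at h
  obtain ⟨k, hk⟩ := (h.eventually (gt_mem_nhds (ENNReal.ofReal_pos.2 hp))).exists
  refine ⟨k, fun a ha => ?_⟩
  refine ENNReal.toReal_le_of_le_ofReal hp.le ((measure_mono fun x hx => ?_).trans hk.le)
  exact le_trans ha (show a ≤ |ψ x| from hx)

theorem measure_many_errors_le {V : Type*} [MeasurableSpace V] (ν : Measure V)
    [IsProbabilityMeasure ν] (n b : ℕ) (E : Set V) [DecidablePred (· ∈ E)] :
    (Measure.pi fun _ : Fin n => ν).real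
      {z | b ≤ (Finset.univ.filter fun τ => z τ ∈ E).card} ≤ 2 ^ n * ν.real E ^ b := by
  have hsub : {z : Fin n → V | b ≤ (Finset.univ.filter fun τ => z τ ∈ E).card} ⊆
      ⋃ S ∈ Finset.powersetCard b (Finset.univ : Finset (Fin n)),
        (S : Set (Fin n)).pi fun _ => E := by
    intro z hz
    obtain ⟨S, hS, hc⟩ := Finset.exists_subset_card_eq hz
    refine Set.mem_biUnion (x := S) (by simp [hc]) fun τ hτ => ?_
    exact (Finset.mem_filter.1 (hS hτ)).2
  calc _ ≤ _ := measureReal_mono hsub (measure_ne_top _ _)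
    _ ≤ ∑ S ∈ Finset.powersetCard b (Finset.univ : Finset (Fin n)),
        (Measure.pi fun _ : Fin n => ν).real ((S : Set (Fin n)).pi fun _ => E) :=
      measureReal_biUnion_finset_le _ _
    _ = ∑ S ∈ Finset.powersetCard b (Finset.univ : Finset (Fin n)), ν.real E ^ b := by
      refine Finset.sum_congr rfl fun S hS => ?_
      rw [measureReal_def, Measure.pi_pi_finset, Finset.prod_const,
        (Finset.mem_powersetCard.1 hS).2,
        ENNReal.toReal_pow, measureReal_def]
    _ ≤ 2 ^ n * ν.real E ^ b := by
      rw [Finset.sum_const, nsmul_eq_mul]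
      gcongr
      rw [Finset.card_powersetCard, Finset.card_univ, Fintype.card_fin]
      exact_mod_cast Nat.choose_le_two_pow n b

end Noise

/-! ### Separating the streams -/

section Separation

variable {M N : Fin 2 → ℕ} {H : Channel M N} {P : Precoding M}

theorem exists_dual_family {V σ : Type*} [AddCommGroup V] [Module ℝ V] [DecidableEq σ] {g : σ → V}
    (hg : LinearIndependent ℝ g) :
    ∃ ψ : σ → V →ₗ[ℝ] ℝ, ∀ i j, ψ i (g j) = if i = j then 1 else 0 := by
  obtain ⟨L, hL⟩ := (Finsupp.linearCombination ℝ g).exists_leftInverse_of_injective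
    (LinearMap.ker_eq_bot.2 hg)
  refine ⟨fun i => Finsupp.lapply i ∘ₗ L, fun i j => ?_⟩
  have : L (g j) = Finsupp.single j 1 := by
    have := LinearMap.congr_fun hL (Finsupp.single j 1)
    simpa using this
  simp [this, Finsupp.single_apply, eq_comm]

theorem real_smul_mulVec {m n : ℕ} (A : Matrix (Fin m) (Fin n) ℂ) (c : ℝ) (x : Fin n → ℂ) :
    A *ᵥ ((c : ℂ) • x) = c • (A *ᵥ x) := by
  rw [Matrix.mulVec_smul]
  ext i
  simp

/-- Real functionals that vanish on the interference at receiver `r` vanish on all that is meant for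
the other receiver: the first two blocks are not heard, and the third blocks of both transmitters
are aligned. -/
theorem IsScheme.interference (h : IsScheme H P) {r : Fin 2} {ψ : (Fin (N r) → ℂ) →ₗ[ℝ] ℝ}
    (hψ : ∀ k, ψ (H.mat r 0 *ᵥ P.u (other r) 0 k) = 0) (t : Fin 2) (k : P.Stream (other r) t) :
    ψ (H.mat r t *ᵥ P.col (other r) t k) = 0 := by
  have hv : ∀ t k, H.mat r t *ᵥ P.v (other r) t k = 0 := by
    fin_cases r
    · exact h.v_null 1
    · exact h.v_null 0
  have hal : ∀ k, Submodule.span ℝ {H.mat r 1 *ᵥ P.u (other r) 1 (Fin.cast (h.len₃_eq _) k)} =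
      Submodule.span ℝ {H.mat r 0 *ᵥ P.u (other r) 0 k} := by
    fin_cases r
    · exact h.aligned 1
    · exact h.aligned 0
  rcases k with k | k | k
  · simp [Precoding.col, hv]
  · simp [Precoding.col, h.w_eq, Matrix.mulVec_smul, hv]
  · fin_cases t
    · exact hψ k
    · obtain ⟨k, rfl⟩ : ∃ l, k = Fin.cast (h.len₃_eq _) l := ⟨Fin.cast (h.len₃_eq _).symm k, rfl⟩
      have hm : H.mat r 1 *ᵥ P.u (other r) 1 (Fin.cast (h.len₃_eq _) k) ∈
          Submodule.span ℝ {H.mat r 0 *ᵥ P.u (other r) 0 k} :=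
        hal k ▸ Submodule.mem_span_singleton_self _
      obtain ⟨c, hc⟩ := Submodule.mem_span_singleton.1 hm
      change ψ (H.mat r 1 *ᵥ P.u (other r) 1 (Fin.cast (h.len₃_eq _) k)) = 0
      rw [← hc, map_smul, hψ, smul_zero]

/-- At each receiver every desired real stream is recovered, free of interference, by a real linear
functional of the received signal. -/
theorem IsScheme.exists_separation (h : IsScheme H P) (r : Fin 2) :
    ∃ ψ : (t : Fin 2) → P.Stream r t → (Fin (N r) → ℂ) →L[ℝ] ℝ,
      ∀ (s : (r' t : Fin 2) → P.Stream r' t → ℝ) t k,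
        ψ t k (∑ t', H.mat r t' *ᵥ ∑ r', ∑ k', ((s r' t' k' : ℝ) : ℂ) • P.col r' t' k') =
          s r t k := by
  classical
  obtain ⟨ψ, hψ⟩ := exists_dual_family (h.separable r)
  refine ⟨fun t k => LinearMap.toContinuousLinearMap (ψ (.inl ⟨t, k⟩)), fun s t k => ?_⟩
  have hint := h.interference (ψ := ψ (.inl ⟨t, k⟩)) fun l => by
    simpa using hψ (.inl ⟨t, k⟩) (.inr l)
  have hdes (t' k') : ψ (.inl ⟨t, k⟩) (H.mat r t' *ᵥ P.col r t' k') =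
      if (⟨t, k⟩ : (t : Fin 2) × P.Stream r t) = ⟨t', k'⟩ then 1 else 0 := by
    simpa using hψ (.inl ⟨t, k⟩) (.inl ⟨t', k'⟩)
  have hsum (f : Fin 2 → ℝ) : ∑ r', f r' = f r + f (other r) := by
    rw [Fin.sum_univ_two]
    fin_cases r
    · rfl
    · exact add_comm _ _
  simp only [LinearMap.coe_toContinuousLinearMap', map_sum, Matrix.mulVec_sum, real_smul_mulVec,
    map_smul, smul_eq_mul]
  have hin (t') : ∑ r', ∑ k', s r' t' k' * ψ (.inl ⟨t, k⟩) (H.mat r t' *ᵥ P.col r' t' k') =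
      ∑ k', s r t' k' * if (⟨t, k⟩ : (t : Fin 2) × P.Stream r t) = ⟨t', k'⟩ then 1 else 0 := by
    rw [hsum]
    simp only [hint, hdes, mul_zero, Finset.sum_const_zero, add_zero]
  simp only [hin]
  rw [← Fintype.sum_sigma' fun t' (k' : P.Stream r t') =>
    s r t' k' * if (⟨t, k⟩ : (t : Fin 2) × P.Stream r t) = ⟨t', k'⟩ then 1 else 0]
  simp

end Separation

/-! ### Codes for a scheme -/

section Achievability

variable {M N : Fin 2 → ℕ} {H : Channel M N} {P : Precoding M}

instance (n : ℕ) (r : Fin 2) : IsProbabilityMeasure (noise N n r) := by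
  unfold noise; infer_instance

theorem Code.errorProb_le {n : ℕ} (c : Code M N n) (r : Fin 2) {ε : ℝ} (hε : 0 ≤ ε)
    (h : ∀ W, (noise N n r).real {z | c.dec r (c.received H r W z) ≠ W r} ≤ ε) :
    c.errorProb H r ≤ ε := by
  rw [Code.errorProb]
  refine div_le_of_le_mul₀ (Nat.cast_nonneg _) hε ?_
  calc _ ≤ ∑ _W : c.Msgs, ε := Finset.sum_le_sum fun W _ => h W
    _ = ε * Fintype.card c.Msgs := by
        rw [Finset.sum_const, nsmul_eq_mul, Finset.card_univ, mul_comm]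

theorem Precoding.card_stream (P : Precoding M) (r t : Fin 2) :
    Fintype.card (P.Stream r t) = P.Q r t := by
  simp [Precoding.Q, add_assoc]

/-- The power per channel use when all real symbols are at most `A` in absolute value. -/
theorem Precoding.power_le (P : Precoding M) (t : Fin 2) (s : (r : Fin 2) → P.Stream r t → ℝ)
    {A : ℝ} (hs : ∀ r k, |s r k| ≤ A) :
    ∑ i, ‖(∑ r, ∑ k, ((s r k : ℝ) : ℂ) • P.col r t k) i‖ ^ 2 ≤
      (∑ t, ∑ i, (∑ r, ∑ k, ‖P.col r t k i‖) ^ 2) * A ^ 2 := by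
  calc _ ≤ ∑ i, ((∑ r, ∑ k, ‖P.col r t k i‖) * A) ^ 2 := by
        refine Finset.sum_le_sum fun i _ => pow_le_pow_left₀ (norm_nonneg _) ?_ 2
        simp only [Finset.sum_apply, Pi.smul_apply, smul_eq_mul, Finset.sum_mul]
        refine (norm_sum_le _ _).trans (Finset.sum_le_sum fun r _ => ?_)
        refine (norm_sum_le _ _).trans (Finset.sum_le_sum fun k _ => ?_)
        rw [norm_mul, Complex.norm_real, Real.norm_eq_abs, mul_comm]
        exact mul_le_mul_of_nonneg_left (hs r k) (norm_nonneg _)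
    _ = (∑ i, (∑ r, ∑ k, ‖P.col r t k i‖) ^ 2) * A ^ 2 := by
        rw [Finset.sum_mul]
        exact Finset.sum_congr rfl fun i _ => mul_pow _ _ _
    _ ≤ _ := by
        refine mul_le_mul_of_nonneg_right ?_ (sq_nonneg A)
        exact Finset.single_le_sum (f := fun t => ∑ i, (∑ r, ∑ k, ‖P.col r t k i‖) ^ 2)
          (fun t _ => Finset.sum_nonneg fun i _ => sq_nonneg _) (Finset.mem_univ t)

/-- Each stream carries a word of the same code, scaled by `a`; receivers separate the streams,
round to the nearest symbol and decode each stream, which fails only if the noise in that stream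
exceeds `a / 2` at least `b` times. -/
theorem IsScheme.exists_code (h : IsScheme H P) (ψ : (r t : Fin 2) → P.Stream r t →
      (Fin (N r) → ℂ) →L[ℝ] ℝ)
    (hψ : ∀ r (s : (r' t : Fin 2) → P.Stream r' t → ℝ) t k,
      ψ r t k (∑ t', H.mat r t' *ᵥ ∑ r', ∑ k', ((s r' t' k' : ℝ) : ℂ) • P.col r' t' k') = s r t k)
    {n K L b : ℕ} (hK : 1 ≤ K) (cw : Fin K → Fin n → Fin L)
    (hcw : ∀ i j, hammingDist (cw i) (cw j) ≤ 2 * b → i = j) {a p : ℝ} (ha : 0 < a)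
    (hp : ∀ r t k, (Measure.pi fun _ => complexGaussian 0 1).real {x | a / 2 ≤ |ψ r t k x|} ≤ p) :
    ∃ c : Code M N n, c.UsesPrecoding P ∧
      (∀ ρ, (∑ t, ∑ i, (∑ r, ∑ k, ‖P.col r t k i‖) ^ 2) * (a * L) ^ 2 ≤ ρ → c.HasPower ρ) ∧
      (∀ r t, c.msg r t = K ^ P.Q r t) ∧
      ∀ r, c.errorProb H r ≤ (∑ t, P.Q r t : ℕ) * (2 ^ n * p ^ b) := by
  classical
  obtain ⟨D, hD⟩ := exists_decoder hK cw hcw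
  let e (r t : Fin 2) : Fin (K ^ P.Q r t) ≃ (P.Stream r t → Fin K) :=
    (Fintype.equivFinOfCardEq (by rw [Fintype.card_fun, Fintype.card_fin, P.card_stream])).symm
  let s (r t : Fin 2) (m : Fin (K ^ P.Q r t)) (τ : Fin n) (k : P.Stream r t) : ℝ :=
    a * ((cw (e r t m k) τ : ℕ) : ℝ)
  let R (r t : Fin 2) (y : Fin n → Fin (N r) → ℂ) (k : P.Stream r t) (τ : Fin n) : ℤ :=
    ⌊ψ r t k (y τ) / a + 1 / 2⌋
  have hR (r t) : Measurable (R r t) := by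
    refine measurable_pi_iff.2 fun k => measurable_pi_iff.2 fun τ => ?_
    have h1 : Measurable fun y : Fin n → Fin (N r) → ℂ => ψ r t k (y τ) :=
      (ψ r t k).continuous.measurable.comp (measurable_pi_apply τ)
    exact ((h1.div_const a).add_const _).floor
  let c : Code M N n :=
    { msg := fun r t => K ^ P.Q r t
      enc := fun t W τ => ∑ r, ∑ k, ((s r t (W r) τ k : ℝ) : ℂ) • P.col r t k
      dec := fun r y t => (e r t).symm fun k => D (R r t y k)
      measurable_dec := fun r => measurable_pi_iff.2 fun t =>
        (measurable_of_countable fun w : P.Stream r t → Fin n → ℤ =>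
          (e r t).symm fun k => D (w k)).comp (hR r t) }
  refine ⟨c, ⟨s, fun t W τ => rfl⟩, fun ρ hρ t W => ?_, fun r t => rfl, fun r => ?_⟩
  · calc _ ≤ ∑ _τ : Fin n, ρ := by
          refine Finset.sum_le_sum fun τ _ => (P.power_le t _ fun r k => ?_).trans hρ
          have hl : ((cw (e r t (W r) k) τ : ℕ) : ℝ) ≤ L := by
            exact_mod_cast (cw (e r t (W r) k) τ).2.le
          rw [abs_of_nonneg (by positivity)]
          exact mul_le_mul_of_nonneg_left hl ha.le
      _ = n * ρ := by simp
  have hp0 : 0 ≤ p := by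
    have := h.active r 0
    rw [← P.card_stream] at this
    obtain ⟨k⟩ := Fintype.card_pos_iff.1 this
    exact measureReal_nonneg.trans (hp r 0 k)
  refine c.errorProb_le r (by positivity) fun W => ?_
  let E (t : Fin 2) (k : P.Stream r t) : Set (Fin (N r) → ℂ) := {x | a / 2 ≤ |ψ r t k x|}
  have hrec (z) (τ) (t) (k) : ψ r t k (c.received H r W z τ) =
      a * ((cw (e r t (W r t) k) τ : ℕ) : ℝ) + ψ r t k (z τ) := by
    rw [Code.received, map_add]
    congr 1
    exact hψ r (fun r' t' k' => s r' t' (W r' t') τ k') t k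
  have hsub : {z | c.dec r (c.received H r W z) ≠ W r} ⊆
      ⋃ x ∈ (Finset.univ : Finset ((t : Fin 2) × P.Stream r t)),
        {z | b ≤ (Finset.univ.filter fun τ => z τ ∈ E x.1 x.2).card} := by
    intro z hz
    by_contra hcon
    simp only [Set.mem_iUnion, Finset.mem_univ, exists_true_left, Set.mem_ofPred_eq, not_exists,
      not_le] at hcon
    refine hz (funext fun t => (e r t).symm_apply_eq.2 (funext fun k => hD _ _ ?_))
    refine (Finset.card_le_card fun τ hτ => ?_).trans_lt (hcon ⟨t, k⟩)
    simp only [Finset.mem_filter, Finset.mem_univ, true_and] at hτ ⊢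
    by_contra hE
    refine hτ ?_
    have hE : |ψ r t k (z τ)| < a / 2 := not_le.1 hE
    rw [abs_lt] at hE
    simp only [R, hrec]
    rw [Int.floor_eq_iff, add_div, mul_div_cancel_left₀ _ ha.ne']
    have h1 : -(1 / 2) < ψ r t k (z τ) / a := by rw [lt_div_iff₀ ha]; linarith
    have h2 : ψ r t k (z τ) / a < 1 / 2 := by rw [div_lt_iff₀ ha]; linarith
    push_cast
    constructor <;> linarith
  calc _ ≤ _ := measureReal_mono hsub (measure_ne_top _ _)
    _ ≤ ∑ x : (t : Fin 2) × P.Stream r t, (noise N n r).real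
        {z | b ≤ (Finset.univ.filter fun τ => z τ ∈ E x.1 x.2).card} :=
      measureReal_biUnion_finset_le _ _
    _ ≤ ∑ x : (t : Fin 2) × P.Stream r t, 2 ^ n * p ^ b := by
      refine Finset.sum_le_sum fun x _ => ?_
      refine (measure_many_errors_le (Measure.pi fun _ => complexGaussian 0 1) n b
        (E x.1 x.2)).trans ?_
      exact mul_le_mul_of_nonneg_left (pow_le_pow_left₀ measureReal_nonneg (hp r x.1 x.2) _)
        (by positivity)
    _ = _ := by
      rw [Finset.sum_const, nsmul_eq_mul, Finset.card_univ, Fintype.card_sigma]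
      simp only [P.card_stream]

theorem AchievableRates.mono {allowed : (n : ℕ) → Code M N n → Prop} {ρ : ℝ}
    {R R' : Fin 2 → Fin 2 → ℝ} (h : AchievableRates allowed H ρ R) (hR : ∀ r t, R' r t ≤ R r t) :
    AchievableRates allowed H ρ R' := by
  intro ε hε
  obtain ⟨n₀, hn⟩ := h ε hε
  refine ⟨n₀, fun n hn' => ?_⟩
  obtain ⟨c, h1, h2, h3, h4⟩ := hn n hn'
  refine ⟨c, h1, h2, fun r t => le_trans ?_ (h3 r t), h4⟩
  exact mul_le_mul_of_nonneg_left (sub_le_sub_right (hR r t) ε) (Nat.cast_nonneg n)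

/-- A spacing `a` of the real symbols that depends only on the wanted loss of rate `2 / m`; the
number `L` of symbols is then limited by the power only. -/
theorem IsScheme.exists_spacing (h : IsScheme H P) {m : ℕ} (hm : 1 ≤ m) :
    ∃ a : ℝ, 0 < a ∧ ∀ L : ℕ, 1 ≤ L → ∀ ρ,
      (∑ t, ∑ i, (∑ r, ∑ k, ‖P.col r t k i‖) ^ 2) * (a * L) ^ 2 ≤ ρ →
      AchievableRates (fun _ c => c.UsesPrecoding P) H ρ
        fun r t => P.Q r t * ((1 - 2 / m) * Real.logb 2 L - 1) := by
  choose ψ hψ using h.exists_separation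
  -- The spacing makes the symbol error probability at most `(1 / 4) ^ m` in every stream.
  have hp : (0 : ℝ) < (1 / 4) ^ m := by positivity
  choose a₀ ha₀ using fun r t k =>
    exists_forall_measure_abs_le (Measure.pi fun _ => complexGaussian 0 1)
      (ψ r t k).continuous.measurable hp
  have hle (r t k) : a₀ r t k ≤ 1 + ∑ r, ∑ t, ∑ k, |a₀ r t k| := by
    have h1 : |a₀ r t k| ≤ ∑ k, |a₀ r t k| :=
      Finset.single_le_sum (f := fun k => |a₀ r t k|) (fun _ _ => abs_nonneg _) (Finset.mem_univ k)
    have h2 : ∑ k, |a₀ r t k| ≤ ∑ t, ∑ k, |a₀ r t k| :=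
      Finset.single_le_sum (f := fun t => ∑ k, |a₀ r t k|)
        (fun _ _ => Finset.sum_nonneg fun _ _ => abs_nonneg _) (Finset.mem_univ t)
    have h3 : ∑ t, ∑ k, |a₀ r t k| ≤ ∑ r, ∑ t, ∑ k, |a₀ r t k| :=
      Finset.single_le_sum (f := fun r => ∑ t, ∑ k, |a₀ r t k|)
        (fun _ _ => Finset.sum_nonneg fun _ _ => Finset.sum_nonneg fun _ _ => abs_nonneg _)
        (Finset.mem_univ r)
    have := le_abs_self (a₀ r t k)
    linarith
  have hpos : 0 ≤ ∑ r, ∑ t, ∑ k, |a₀ r t k| :=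
    Finset.sum_nonneg fun _ _ => Finset.sum_nonneg fun _ _ => Finset.sum_nonneg fun _ _ =>
      abs_nonneg _
  refine ⟨2 * (1 + ∑ r, ∑ t, ∑ k, |a₀ r t k|), by linarith, fun L hL ρ hρ ε hε => ?_⟩
  have hL0 : (0 : ℝ) < L := by exact_mod_cast hL
  have hl : 0 ≤ Real.logb 2 L := Real.logb_nonneg one_lt_two (by exact_mod_cast hL)
  have hev : ∀ᶠ n : ℕ in atTop, (∀ r t, P.Q r t * (2 * Real.logb 2 L) ≤ n * ε) ∧
      ∀ r, (∑ t, P.Q r t : ℕ) * ((1 : ℝ) / 2) ^ n ≤ ε := by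
    refine .and (eventually_all.2 fun r => eventually_all.2 fun t => ?_)
      (eventually_all.2 fun r => ?_)
    · exact (tendsto_natCast_atTop_atTop.atTop_mul_const hε).eventually_ge_atTop _
    · have := (tendsto_pow_atTop_nhds_zero_of_lt_one (r := (1 : ℝ) / 2) (by norm_num)
        (by norm_num)).const_mul ((∑ t, P.Q r t : ℕ) : ℝ)
      rw [mul_zero] at this
      exact this.eventually_le_const hε
  obtain ⟨n₀, hn₀⟩ := eventually_atTop.1 hev
  refine ⟨n₀, fun n hn => ?_⟩
  obtain ⟨hn1, hn2⟩ := hn₀ n hn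
  -- More than `n / m` errors in a stream have probability at most `2 ^ n * (1 / 4) ^ n`.
  obtain ⟨K, cw, hK, hcw, hcard⟩ := exists_code_hammingDist n L (2 * (n / m + 1)) hL
  obtain ⟨c, hc1, hc2, hc3, hc4⟩ := h.exists_code ψ hψ hK cw hcw
    (a := 2 * (1 + ∑ r, ∑ t, ∑ k, |a₀ r t k|)) (by linarith) (p := (1 / 4) ^ m)
    (fun r t k => ha₀ r t k _ (by have := hle r t k; linarith))
  refine ⟨c, hc1, hc2 ρ hρ, fun r t => ?_, fun r => (hc4 r).trans (le_trans ?_ (hn2 r))⟩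
  · have hK0 : (0 : ℝ) < K := by exact_mod_cast hK
    have hb : ((n / m : ℕ) : ℝ) ≤ n / m := Nat.cast_div_le
    have hlog : n * Real.logb 2 L ≤
        Real.logb 2 K + (n + (2 * ((n / m : ℕ) + 1)) * Real.logb 2 L) := by
      have h1 : (L : ℝ) ^ n ≤ K * (2 ^ n * L ^ (2 * (n / m + 1))) := by exact_mod_cast hcard
      have h2 := (Real.logb_le_logb one_lt_two (by positivity) (by positivity)).2 h1
      rw [Real.logb_mul (by positivity) (by positivity), Real.logb_mul (by positivity)
        (by positivity), Real.logb_pow, Real.logb_pow, Real.logb_pow,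
        Real.logb_self_eq_one one_lt_two] at h2
      push_cast at h2
      linarith
    have h3 : ((n / m : ℕ) : ℝ) * Real.logb 2 L ≤ n / m * Real.logb 2 L :=
      mul_le_mul_of_nonneg_right hb hl
    have h4 : (n : ℝ) * ((1 - 2 / m) * Real.logb 2 L - 1) ≤
        Real.logb 2 K + 2 * Real.logb 2 L := by
      have : (n : ℝ) * ((1 - 2 / m) * Real.logb 2 L - 1) =
        n * Real.logb 2 L - 2 * (n / m * Real.logb 2 L) - n := by ring
      linarith
    rw [hc3, Nat.cast_pow, Real.logb_pow]
    have h5 := mul_le_mul_of_nonneg_left h4 (Nat.cast_nonneg (α := ℝ) (P.Q r t))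
    have h6 := hn1 r t
    linarith
  · refine mul_le_mul_of_nonneg_left ?_ (Nat.cast_nonneg _)
    have hmb : n ≤ m * (n / m + 1) := (Nat.lt_mul_div_succ n hm).le
    rw [← pow_mul]
    calc (2 : ℝ) ^ n * (1 / 4) ^ (m * (n / m + 1)) ≤ 2 ^ n * (1 / 4) ^ n := by
          refine mul_le_mul_of_nonneg_left ?_ (by positivity)
          exact pow_le_pow_of_le_one (by norm_num) (by norm_num) hmb
      _ = (1 / 2) ^ n := by rw [← mul_pow]; norm_num

theorem IsScheme.eventually_achievableRates (h : IsScheme H P) {κ : ℝ} (hκ : 0 < κ) :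
    ∀ᶠ ρ in atTop, AchievableRates (fun _ c => c.UsesPrecoding P) H ρ
      fun r t => P.Q r t / 2 * ((1 - κ) * Real.logb 2 ρ) := by
  obtain ⟨m, hm⟩ := exists_nat_gt (4 / κ + 2)
  have hm4 : 0 < 4 / κ := by positivity
  have hm0 : (0 : ℝ) < m := by linarith
  have hm1 : 1 ≤ m := by exact_mod_cast (show (0 : ℝ) < m from hm0)
  have hmκ : 2 / (m : ℝ) ≤ κ / 2 := by
    rw [div_le_div_iff₀ hm0 two_pos]
    have : 4 / κ * κ ≤ m * κ := mul_le_mul_of_nonneg_right (by linarith) hκ.le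
    rw [div_mul_cancel₀ _ hκ.ne'] at this
    linarith
  have hm2 : 2 / (m : ℝ) ≤ 1 := by rw [div_le_one hm0]; linarith
  obtain ⟨a, ha, hach⟩ := h.exists_spacing hm1
  set C := ∑ t, ∑ i, (∑ r, ∑ k, ‖P.col r t k i‖) ^ 2 with hC
  have hC0 : 0 ≤ C := Finset.sum_nonneg fun t _ => Finset.sum_nonneg fun i _ => sq_nonneg _
  set B := a * √(C + 1) with hB
  have hB0 : 0 < B := by positivity
  have hx : Tendsto (fun ρ : ℝ => √ρ / B) atTop atTop :=
    Real.tendsto_sqrt_atTop.atTop_div_const hB0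
  have hlog : Tendsto (fun ρ : ℝ => Real.logb 2 ρ) atTop atTop :=
    Real.tendsto_logb_atTop one_lt_two
  filter_upwards [hx.eventually_ge_atTop 2, eventually_gt_atTop 0, hlog.eventually_ge_atTop
    (4 / κ * (|Real.logb 2 (2 * B)| + 1))] with ρ h2 hρ hl
  set L := ⌊√ρ / B⌋₊ with hLdef
  have hLle : (L : ℝ) ≤ √ρ / B := Nat.floor_le (by positivity)
  have hLge : √ρ / (2 * B) ≤ L := by
    have := Nat.lt_floor_add_one (√ρ / B)
    have e : √ρ / (2 * B) = √ρ / B / 2 := by rw [div_div, mul_comm]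
    rw [e]
    linarith
  have hL1 : 1 ≤ L := Nat.le_floor (by norm_num; linarith)
  have hpow : C * (a * L) ^ 2 ≤ ρ := by
    have h3 : (L : ℝ) * B ≤ √ρ := (le_div_iff₀ hB0).1 hLle
    have h4 : (L * B) ^ 2 ≤ ρ := by
      rw [← Real.sq_sqrt hρ.le]
      exact pow_le_pow_left₀ (by positivity) h3 2
    have h5 : ((L : ℝ) * B) ^ 2 = (C + 1) * (a * L) ^ 2 := by
      rw [hB, mul_pow, mul_pow, Real.sq_sqrt (by linarith)]
      ring
    nlinarith [sq_nonneg (a * L)]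
  refine (hach L hL1 ρ hpow).mono fun r t => ?_
  have hlL : Real.logb 2 ρ / 2 - Real.logb 2 (2 * B) ≤ Real.logb 2 L := by
    have h3 := Real.logb_le_logb_of_le one_lt_two (by positivity) hLge
    rwa [Real.logb_div (by positivity) (by positivity), Real.sqrt_eq_rpow,
      Real.logb_rpow_eq_mul_logb_of_pos hρ, one_div, inv_mul_eq_div] at h3
  have h6 : (κ / 4) * Real.logb 2 ρ ≥ |Real.logb 2 (2 * B)| + 1 := by
    have := mul_le_mul_of_nonneg_left hl (show 0 ≤ κ / 4 by positivity)
    have e : κ / 4 * (4 / κ * (|Real.logb 2 (2 * B)| + 1)) = |Real.logb 2 (2 * B)| + 1 := by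
      field_simp
    linarith
  have hlρ : 0 ≤ Real.logb 2 ρ := le_trans (by positivity) hl
  rw [div_mul_eq_mul_div, mul_div_assoc]
  refine mul_le_mul_of_nonneg_left ?_ (Nat.cast_nonneg _)
  have h7 : (1 - 2 / (m : ℝ)) * (Real.logb 2 ρ / 2 - Real.logb 2 (2 * B)) ≤
      (1 - 2 / (m : ℝ)) * Real.logb 2 L := mul_le_mul_of_nonneg_left hlL (by linarith)
  have h8 : (1 - 2 / (m : ℝ)) * Real.logb 2 (2 * B) ≤ |Real.logb 2 (2 * B)| := by
    refine (le_abs_self _).trans ?_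
    rw [abs_mul, abs_of_nonneg (by linarith : (0 : ℝ) ≤ 1 - 2 / m)]
    have : 0 < 2 / (m : ℝ) := by positivity
    exact mul_le_of_le_one_left (abs_nonneg _) (by linarith)
  have h9 : 2 / (m : ℝ) * Real.logb 2 ρ ≤ κ / 2 * Real.logb 2 ρ :=
    mul_le_mul_of_nonneg_right hmκ hlρ
  linarith

theorem achievableRates_zero (H : Channel M N) (P : Precoding M) {ρ : ℝ} (hρ : 0 < ρ) :
    AchievableRates (fun _ c => c.UsesPrecoding P) H ρ fun _ _ => 0 := by
  intro ε hε
  refine ⟨0, fun n _ => ?_⟩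
  let c : Code M N n :=
    { msg := fun _ _ => 1
      enc := fun _ _ _ => 0
      dec := fun _ _ _ => 0
      measurable_dec := fun _ => measurable_const }
  refine ⟨c, ⟨fun _ _ _ _ _ => 0, fun t W τ => by simp [c]⟩, fun t W => ?_, fun r t => ?_,
    fun r => c.errorProb_le r hε.le fun W => ?_⟩
  · simp [c]
    positivity
  · have : (n : ℝ) * (0 - ε) ≤ 0 :=
      mul_nonpos_of_nonneg_of_nonpos (Nat.cast_nonneg n) (by linarith)
    simpa [c] using this
  · have he : ∀ z, c.dec r (c.received H r W z) = W r := fun z =>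
      funext fun t => Subsingleton.elim (α := Fin 1) _ _
    simp [he, hε.le]

/-- Rates that are achievable up to every loss factor `1 - κ` for large power can be chosen with the
full number of degrees of freedom: let `κ` decrease slowly with the power. -/
theorem IsScheme.achievableDoF (h : IsScheme H P) :
    AchievableDoF (fun _ c => c.UsesPrecoding P) H fun r t => (P.Q r t : ℝ) / 2 := by
  classical
  let good (ρ : ℝ) (k : ℕ) : Prop := AchievableRates (fun _ c => c.UsesPrecoding P) H ρ
    fun r t => P.Q r t / 2 * ((1 - 1 / ((k : ℝ) + 1)) * Real.logb 2 ρ)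
  let f (ρ : ℝ) : ℕ := Nat.findGreatest (good ρ) ⌊ρ⌋₊
  have hgood : ∀ ρ, 0 < ρ → good ρ (f ρ) := fun ρ hρ =>
    Nat.findGreatest_spec (m := 0) (Nat.zero_le _) ((achievableRates_zero H P hρ).mono (by simp))
  have hf : Tendsto f atTop atTop := by
    refine tendsto_atTop.2 fun k => ?_
    filter_upwards [h.eventually_achievableRates (κ := 1 / ((k : ℝ) + 1)) (by positivity),
      eventually_ge_atTop (k : ℝ)] with ρ h1 h2
    exact Nat.le_findGreatest (Nat.le_floor h2) h1
  refine ⟨fun ρ r t => P.Q r t / 2 * ((1 - 1 / ((f ρ : ℝ) + 1)) * Real.logb 2 ρ), hgood,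
    fun r t => ?_⟩
  have h1 : Tendsto (fun ρ => (P.Q r t : ℝ) / 2 * (1 - 1 / ((f ρ : ℝ) + 1))) atTop
      (𝓝 (P.Q r t / 2 * (1 - 0))) :=
    ((tendsto_one_div_add_atTop_nhds_zero_nat.comp hf).const_sub 1).const_mul _
  rw [sub_zero, mul_one] at h1
  refine h1.congr' ?_
  filter_upwards [eventually_gt_atTop 1] with ρ hρ
  have : Real.logb 2 ρ ≠ 0 := (Real.logb_pos one_lt_two hρ).ne'
  rw [← mul_assoc, mul_div_assoc, div_self this, mul_one]

end Achievability

/-! ### Domination of shifted Gaussian noise -/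

section Domination

/-- A shifted Gaussian law is dominated by a wider centred one:
`y ^ 2 ≤ 2 * (y - x) ^ 2 + 2 * x ^ 2` bounds the ratio of the densities. -/
theorem gaussianReal_le (x : ℝ) {s : ℝ≥0} (hs : 2 ≤ s) :
    gaussianReal x (1 / 2) ≤
      ENNReal.ofReal (√s * Real.exp (2 * x ^ 2 / s)) • gaussianReal 0 (s / 2) := by
  have hs0 : (0 : ℝ) < s := by
    have : (2 : ℝ) ≤ s := by exact_mod_cast hs
    linarith
  have hs2 : s / 2 ≠ 0 := by
    have : s ≠ 0 := by rintro rfl; simp at hs0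
    exact div_ne_zero this two_ne_zero
  rw [gaussianReal_of_var_ne_zero _ (by norm_num), gaussianReal_of_var_ne_zero _ hs2,
    ← withDensity_smul _ (measurable_gaussianPDF _ _)]
  refine withDensity_mono (ae_of_all _ fun y => ?_)
  simp only [Pi.smul_apply, smul_eq_mul, gaussianPDF]
  rw [← ENNReal.ofReal_mul (by positivity)]
  refine ENNReal.ofReal_le_ofReal ?_
  simp only [gaussianPDFReal]
  push_cast
  have e1 : 2 * Real.pi * (1 / 2) = Real.pi := by ring
  have e2 : 2 * Real.pi * ((s : ℝ) / 2) = s * Real.pi := by ring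
  rw [e1, e2, Real.sqrt_mul hs0.le, mul_inv]
  have e3 : √(s : ℝ) * Real.exp (2 * x ^ 2 / s) * ((√s)⁻¹ * (√Real.pi)⁻¹ *
      Real.exp (-(y - 0) ^ 2 / (2 * (s / 2)))) =
      (√Real.pi)⁻¹ * Real.exp (2 * x ^ 2 / s + -(y - 0) ^ 2 / (2 * (s / 2))) := by
    have : √(s : ℝ) ≠ 0 := (Real.sqrt_pos.2 hs0).ne'
    rw [Real.exp_add]
    field_simp
  rw [e3]
  refine mul_le_mul_of_nonneg_left (Real.exp_le_exp.2 ?_) (by positivity)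
  have e4 : 2 * x ^ 2 / s + -(y - 0) ^ 2 / (2 * ((s : ℝ) / 2)) = (2 * x ^ 2 - y ^ 2) / s := by
    field_simp
    ring
  rw [e4, le_div_iff₀ hs0]
  have h2 : (2 : ℝ) ≤ s := by exact_mod_cast hs
  have e5 : -(y - x) ^ 2 / (2 * (1 / 2)) * (s : ℝ) = -((y - x) ^ 2 * s) := by ring
  rw [e5]
  nlinarith [mul_le_mul_of_nonneg_left h2 (sq_nonneg (y - x)), sq_nonneg (y - 2 * x)]

theorem complexGaussian_le (x : ℂ) {s : ℝ≥0} (hs : 2 ≤ s) :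
    complexGaussian x 1 ≤
      ENNReal.ofReal (s * Real.exp (2 * ‖x‖ ^ 2 / s)) • complexGaussian 0 s := by
  have h := Measure.prod_mono (gaussianReal_le x.re hs) (gaussianReal_le x.im hs)
  rw [Measure.prod_smul_left, Measure.prod_smul_right, smul_smul,
    ← ENNReal.ofReal_mul (by positivity)] at h
  have e : √(s : ℝ) * Real.exp (2 * x.re ^ 2 / s) * (√s * Real.exp (2 * x.im ^ 2 / s)) =
      s * Real.exp (2 * ‖x‖ ^ 2 / s) := by
    rw [Complex.sq_norm, Complex.normSq_apply, mul_mul_mul_comm,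
      Real.mul_self_sqrt (NNReal.coe_nonneg s),
      ← Real.exp_add]
    congr 2
    ring
  rw [e] at h
  have := Measure.map_mono h Complex.measurableEquivRealProd.symm.measurable
  rw [Measure.map_smul] at this
  exact this

theorem complexGaussian_map_const_add (x : ℂ) :
    (complexGaussian 0 1).map (fun z => x + z) = complexGaussian x 1 := by
  have h1 : Measurable fun z : ℂ => x + z := measurable_const_add x
  have hr : (gaussianReal x.re (1 / 2)).prod (gaussianReal x.im (1 / 2)) =
      ((gaussianReal 0 (1 / 2)).prod (gaussianReal 0 (1 / 2))).map
        (Prod.map (fun y => x.re + y) fun y => x.im + y) := by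
    rw [← Measure.map_prod_map _ _ (measurable_const_add _) (measurable_const_add _),
      gaussianReal_map_const_add, gaussianReal_map_const_add, zero_add, zero_add]
  rw [complexGaussian, complexGaussian, hr, Measure.map_map h1 (MeasurableEquiv.measurable _),
    Measure.map_map (MeasurableEquiv.measurable _)
      ((measurable_const_add _).prodMap (measurable_const_add _))]
  refine congrArg (Measure.map · _) (funext fun p => ?_)
  apply Complex.ext <;> simp [Complex.measurableEquivRealProd]

/-- Domination of finite measures passes to products. -/
theorem pi_le_smul_pi {ι : Type*} [Fintype ι] {X : ι → Type*} [∀ i, MeasurableSpace (X i)]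
    {μ ν : (i : ι) → Measure (X i)} [∀ i, IsFiniteMeasure (μ i)] [∀ i, IsFiniteMeasure (ν i)]
    {c : ι → ENNReal} (hc0 : ∀ i, c i ≠ 0) (hc : ∀ i, c i ≠ ⊤) (h : ∀ i, μ i ≤ c i • ν i) :
    Measure.pi μ ≤ (∏ i, c i) • Measure.pi ν := by
  have hp0 : ∏ i, c i ≠ 0 := Finset.prod_ne_zero_iff.2 fun i _ => hc0 i
  have hp : ∏ i, c i ≠ ⊤ := ENNReal.prod_ne_top fun i _ => hc i
  have key : (∏ i, c i)⁻¹ • (Measure.pi μ).toOuterMeasure ≤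
      OuterMeasure.pi fun i => (ν i).toOuterMeasure := by
    refine OuterMeasure.le_pi.2 fun s _ => ?_
    change (∏ i, c i)⁻¹ * Measure.pi μ (Set.univ.pi s) ≤ ∏ i, ν i (s i)
    rw [Measure.pi_pi]
    have h1 : ∏ i, μ i (s i) ≤ (∏ i, c i) * ∏ i, ν i (s i) := by
      rw [← Finset.prod_mul_distrib]
      exact Finset.prod_le_prod' fun i _ => h i (s i)
    calc _ ≤ (∏ i, c i)⁻¹ * ((∏ i, c i) * ∏ i, ν i (s i)) := by gcongr
      _ = _ := by rw [← mul_assoc, ENNReal.inv_mul_cancel hp0 hp, one_mul]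
  refine Measure.le_iff.2 fun A hA => ?_
  have h2 := key A
  change (∏ i, c i)⁻¹ * Measure.pi μ A ≤ _ at h2
  have h3 : Measure.pi ν A = OuterMeasure.pi (fun i => (ν i).toOuterMeasure) A := by
    rw [Measure.pi, toMeasure_apply _ _ hA]
  change _ ≤ (∏ i, c i) * Measure.pi ν A
  rw [h3]
  calc Measure.pi μ A = (∏ i, c i) * ((∏ i, c i)⁻¹ * Measure.pi μ A) := by
        rw [← mul_assoc, ENNReal.mul_inv_cancel hp0 hp, one_mul]
    _ ≤ _ := by gcongr

/-- The wide Gaussian law with which all laws of a received signal are compared. -/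
noncomputable def wideNoise (N : Fin 2 → ℕ) (n : ℕ) (r : Fin 2) (s : ℝ≥0) :
    Measure (Fin n → Fin (N r) → ℂ) :=
  Measure.pi fun _ => Measure.pi fun _ => complexGaussian 0 s

instance (N : Fin 2 → ℕ) (n : ℕ) (r : Fin 2) (s : ℝ≥0) :
    IsProbabilityMeasure (wideNoise N n r s) := by
  unfold wideNoise; infer_instance

theorem noise_map_const_add_le {N : Fin 2 → ℕ} {n : ℕ} (r : Fin 2) (x : Fin n → Fin (N r) → ℂ)
    {s : ℝ≥0} (hs : 2 ≤ s) :
    (noise N n r).map (fun z => x + z) ≤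
      ENNReal.ofReal ((s : ℝ) ^ (n * N r) * Real.exp (2 * (∑ τ, ∑ i, ‖x τ i‖ ^ 2) / s)) •
        wideNoise N n r s := by
  have hs0 : (0 : ℝ) < s := by
    have : (2 : ℝ) ≤ s := by exact_mod_cast hs
    linarith
  have h1 : (noise N n r).map (fun z => x + z) =
      Measure.pi fun τ => Measure.pi fun i => complexGaussian (x τ i) 1 := by
    have h2 (τ) : (Measure.pi fun _ : Fin (N r) => complexGaussian 0 1).map (fun z => x τ + z) =
        Measure.pi fun i => complexGaussian (x τ i) 1 := by
      have := Measure.pi_map_pi (μ := fun _ : Fin (N r) => complexGaussian 0 1)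
        (f := fun i z => x τ i + z) fun i => (measurable_const_add _).aemeasurable
      simp only [complexGaussian_map_const_add] at this
      exact this
    have := Measure.pi_map_pi
      (μ := fun _ : Fin n => Measure.pi fun _ : Fin (N r) => complexGaussian 0 1)
      (f := fun τ z => x τ + z) fun τ => (measurable_const_add _).aemeasurable
    simp only [h2] at this
    exact this
  rw [h1]
  have hpos (τ i) : 0 < (s : ℝ) * Real.exp (2 * ‖x τ i‖ ^ 2 / s) := by positivity
  refine (pi_le_smul_pi (c := fun τ => ∏ i, ENNReal.ofReal (s * Real.exp (2 * ‖x τ i‖ ^ 2 / s)))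
    (ν := fun _ => Measure.pi fun _ => complexGaussian 0 s) (fun τ => ?_) (fun τ => ?_)
    fun τ => pi_le_smul_pi (fun i => ?_) (fun i => ENNReal.ofReal_ne_top)
      fun i => complexGaussian_le _ hs).trans (le_of_eq ?_)
  · exact Finset.prod_ne_zero_iff.2 fun i _ => (ENNReal.ofReal_pos.2 (hpos τ i)).ne'
  · exact ENNReal.prod_ne_top fun i _ => ENNReal.ofReal_ne_top
  · exact (ENNReal.ofReal_pos.2 (hpos τ i)).ne'
  · congr 1
    simp only [← ENNReal.ofReal_prod_of_nonneg fun i _ => (hpos _ i).le]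
    rw [← ENNReal.ofReal_prod_of_nonneg fun τ _ => Finset.prod_nonneg fun i _ => (hpos τ i).le]
    congr 1
    simp only [Finset.prod_mul_distrib, Finset.prod_const, Finset.card_univ, Fintype.card_fin,
      ← Real.exp_sum, ← pow_mul]
    rw [mul_comm (N r) n]
    congr 2
    simp only [← Finset.sum_div, ← Finset.mul_sum]

end Domination

/-! ### The outer bound -/

section Converse

variable {M N : Fin 2 → ℕ}

/-- A bound on the power gain of the channel. -/
theorem exists_gain (H : Channel M N) : ∃ G : ℝ, 0 ≤ G ∧ ∀ r (x : (t : Fin 2) → Fin (M t) → ℂ),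
    ∑ i, ‖(∑ t, H.mat r t *ᵥ x t) i‖ ^ 2 ≤ G * ∑ t, ∑ j, ‖x t j‖ ^ 2 := by
  have h1 (r i) (x : (t : Fin 2) → Fin (M t) → ℂ) : ‖(∑ t, H.mat r t *ᵥ x t) i‖ ^ 2 ≤
      (∑ t, ∑ j, ‖H r t i j‖ ^ 2) * ∑ t, ∑ j, ‖x t j‖ ^ 2 := by
    have h2 : ‖(∑ t, H.mat r t *ᵥ x t) i‖ ≤
        ∑ p : (t : Fin 2) × Fin (M t), ‖H r p.1 i p.2‖ * ‖x p.1 p.2‖ := by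
      rw [Fintype.sum_sigma, Finset.sum_apply]
      refine (norm_sum_le _ _).trans (Finset.sum_le_sum fun t _ => ?_)
      change ‖∑ j, H r t i j * x t j‖ ≤ _
      refine (norm_sum_le _ _).trans (Finset.sum_le_sum fun j _ => ?_)
      rw [norm_mul]
    refine (pow_le_pow_left₀ (norm_nonneg _) h2 2).trans ?_
    refine (Finset.sum_mul_sq_le_sq_mul_sq _ _ _).trans (le_of_eq ?_)
    rw [Fintype.sum_sigma, Fintype.sum_sigma]
  refine ⟨∑ r, ∑ i, ∑ t, ∑ j, ‖H r t i j‖ ^ 2, by positivity, fun r x => ?_⟩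
  calc _ ≤ ∑ i, (∑ t, ∑ j, ‖H r t i j‖ ^ 2) * ∑ t, ∑ j, ‖x t j‖ ^ 2 :=
        Finset.sum_le_sum fun i _ => h1 r i x
    _ = (∑ i, ∑ t, ∑ j, ‖H r t i j‖ ^ 2) * ∑ t, ∑ j, ‖x t j‖ ^ 2 := by rw [Finset.sum_mul]
    _ ≤ _ := by
      refine mul_le_mul_of_nonneg_right ?_ (by positivity)
      exact Finset.single_le_sum (f := fun r => ∑ i, ∑ t, ∑ j, ‖H r t i j‖ ^ 2)
        (fun r _ => by positivity) (Finset.mem_univ r)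

variable {H : Channel M N} {n : ℕ}

/-- There is always a message, since the decoder has to output one. -/
theorem Code.msg_pos (c : Code M N n) (r t : Fin 2) : 0 < c.msg r t :=
  Fin.pos (c.dec r 0 t)

theorem Code.measurableSet_fiber (c : Code M N n) (r : Fin 2) (w : (t : Fin 2) → Fin (c.msg r t)) :
    MeasurableSet {y | c.dec r y = w} :=
  c.measurable_dec r (measurableSet_singleton w)

/-- The decoding regions of a receiver partition the space. -/
theorem Code.sum_fiber (c : Code M N n) (r : Fin 2) (μ : Measure (Fin n → Fin (N r) → ℂ))
    [IsProbabilityMeasure μ] : ∑ w, μ.real {y | c.dec r y = w} = 1 := by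
  have h := measureReal_biUnion_finset (μ := μ) (s := Finset.univ)
    (f := fun w => {y | c.dec r y = w})
    (fun w _ w' _ hne => Set.disjoint_left.2 fun y h h' => hne (h.symm.trans h'))
    (fun w _ => c.measurableSet_fiber r w)
  rw [← h]
  convert probReal_univ (μ := μ)
  ext y
  simp

/-- Given the messages, the received block is dominated by the wide Gaussian law of variance of the
order of the power. -/
theorem Code.correct_le (c : Code M N n) {ρ : ℝ} (hρ : 0 < ρ) (hc : c.HasPower ρ) {G : ℝ}
    (hG0 : 0 ≤ G) (hG : ∀ r (x : (t : Fin 2) → Fin (M t) → ℂ),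
      ∑ i, ‖(∑ t, H.mat r t *ᵥ x t) i‖ ^ 2 ≤ G * ∑ t, ∑ j, ‖x t j‖ ^ 2)
    {s : ℝ≥0} (hs : (s : ℝ) = 2 * G * ρ + 2) (r : Fin 2) (W : c.Msgs) :
    (noise N n r).real {z | c.dec r (c.received H r W z) = W r} ≤
      (s : ℝ) ^ (n * N r) * Real.exp (2 * n) * (wideNoise N n r s).real {y | c.dec r y = W r} := by
  have hs2 : (2 : ℝ≥0) ≤ s := by
    have : (2 : ℝ) ≤ s := by rw [hs]; nlinarith [mul_nonneg hG0 hρ.le]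
    exact_mod_cast this
  have hs0 : (0 : ℝ) < s := by rw [hs]; positivity
  let x : Fin n → Fin (N r) → ℂ := fun τ => ∑ t, H.mat r t *ᵥ c.enc t (fun r' => W r' t) τ
  have hx : ∑ τ, ∑ i, ‖x τ i‖ ^ 2 ≤ n * s := by
    calc _ ≤ ∑ τ, G * ∑ t, ∑ j, ‖c.enc t (fun r' => W r' t) τ j‖ ^ 2 :=
          Finset.sum_le_sum fun τ _ => hG r fun t => c.enc t (fun r' => W r' t) τ
      _ = G * ∑ t, ∑ τ, ∑ j, ‖c.enc t (fun r' => W r' t) τ j‖ ^ 2 := by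
          rw [← Finset.mul_sum, Finset.sum_comm]
      _ ≤ G * ∑ _t : Fin 2, n * ρ := by
          gcongr with t
          exact hc t _
      _ ≤ n * s := by
          rw [hs, Fin.sum_univ_two]
          nlinarith [Nat.cast_nonneg (α := ℝ) n]
  have hm : MeasurableSet {y | c.dec r y = W r} := c.measurableSet_fiber r (W r)
  have h1 : (noise N n r) {z | c.dec r (c.received H r W z) = W r} =
      (noise N n r).map (fun z => x + z) {y | c.dec r y = W r} := by
    rw [Measure.map_apply (measurable_const_add x) hm]
    rfl
  have h2 := noise_map_const_add_le r x hs2 {y | c.dec r y = W r}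
  rw [← h1] at h2
  have h3 := ENNReal.toReal_mono
    (by rw [Measure.smul_apply, smul_eq_mul]
        exact ENNReal.mul_ne_top ENNReal.ofReal_ne_top (measure_ne_top _ _)) h2
  rw [Measure.smul_apply, smul_eq_mul, ENNReal.toReal_mul,
    ENNReal.toReal_ofReal (by positivity)] at h3
  refine h3.trans (mul_le_mul_of_nonneg_right ?_ ENNReal.toReal_nonneg)
  gcongr
  rw [div_le_iff₀ hs0]
  linarith

/-- A code with error probabilities at most `1 / 4` has at most about `ρ ^ (n (N 0 + N 1))`
messages: at each receiver the probability of correct decoding is at most a constant times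
the mass that one law, the same for all messages, gives to the decoding region. -/
theorem Code.card_msgs_le (c : Code M N n) {ρ : ℝ} (hρ : 0 < ρ) (hc : c.HasPower ρ) {G : ℝ}
    (hG0 : 0 ≤ G) (hG : ∀ r (x : (t : Fin 2) → Fin (M t) → ℂ),
      ∑ i, ‖(∑ t, H.mat r t *ᵥ x t) i‖ ^ 2 ≤ G * ∑ t, ∑ j, ‖x t j‖ ^ 2)
    (he : ∀ r, c.errorProb H r ≤ 1 / 4) :
    (Fintype.card c.Msgs : ℝ) ≤ 2 * ((2 * G * ρ + 2) ^ (n * (N 0 + N 1)) * Real.exp (4 * n)) := by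
  obtain ⟨s, hs⟩ : ∃ s : ℝ≥0, (s : ℝ) = 2 * G * ρ + 2 :=
    ⟨⟨2 * G * ρ + 2, by positivity⟩, rfl⟩
  let p (r : Fin 2) (W : c.Msgs) : ℝ :=
    (noise N n r).real {z | c.dec r (c.received H r W z) = W r}
  let q (r : Fin 2) (w : (t : Fin 2) → Fin (c.msg r t)) : ℝ :=
    (wideNoise N n r s).real {y | c.dec r y = w}
  let K (r : Fin 2) : ℝ := (s : ℝ) ^ (n * N r) * Real.exp (2 * n)
  have hpK (r W) : p r W ≤ K r * q r (W r) := c.correct_le hρ hc hG0 hG hs r W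
  have hp0 (r W) : 0 ≤ p r W := measureReal_nonneg
  have hp1 (r W) : p r W ≤ 1 := measureReal_le_one
  have hcard : (0 : ℝ) < Fintype.card c.Msgs := by
    have : Nonempty c.Msgs := ⟨fun r t => ⟨0, c.msg_pos r t⟩⟩
    exact_mod_cast Fintype.card_pos
  have hrec (r W) : Measurable (c.received H r W) := measurable_const_add
    (fun τ => ∑ t, H.mat r t *ᵥ c.enc t (fun r' => W r' t) τ)
  have hsum (r) : 3 / 4 * (Fintype.card c.Msgs : ℝ) ≤ ∑ W, p r W := by
    have h1 := he r
    rw [Code.errorProb, div_le_iff₀ hcard] at h1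
    have h2 (W : c.Msgs) : (noise N n r).real {z | c.dec r (c.received H r W z) ≠ W r} =
        1 - p r W := by
      have := probReal_compl_eq_one_sub (μ := noise N n r)
        ((hrec r W) (c.measurableSet_fiber r (W r)))
      exact this
    simp only [h2] at h1
    rw [Finset.sum_sub_distrib, Finset.sum_const, nsmul_eq_mul, mul_one, Finset.card_univ] at h1
    linarith
  have hprod : ∑ W, p 0 W * p 1 W ≤ K 0 * K 1 := by
    calc ∑ W, p 0 W * p 1 W ≤ ∑ W : c.Msgs, K 0 * K 1 * ∏ r, q r (W r) := by
          refine Finset.sum_le_sum fun W _ => ?_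
          rw [Fin.prod_univ_two]
          calc _ ≤ (K 0 * q 0 (W 0)) * (K 1 * q 1 (W 1)) :=
                mul_le_mul (hpK 0 W) (hpK 1 W) (hp0 1 W) ((hp0 0 W).trans (hpK 0 W))
            _ = _ := by ring
      _ = K 0 * K 1 * ∏ r, ∑ w, q r w := by
          rw [← Finset.mul_sum, Finset.prod_univ_sum, Fintype.piFinset_univ]
      _ = K 0 * K 1 := by
          simp [q, c.sum_fiber]
  -- The product of the two probabilities stands for the joint event, whatever the joint law is.
  have hlow : ∑ W, (p 0 W + p 1 W - 1) ≤ ∑ W, p 0 W * p 1 W := by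
    refine Finset.sum_le_sum fun W _ => ?_
    nlinarith [mul_nonneg (sub_nonneg.2 (hp1 0 W)) (sub_nonneg.2 (hp1 1 W))]
  rw [Finset.sum_sub_distrib, Finset.sum_add_distrib, Finset.sum_const, nsmul_eq_mul, mul_one,
    Finset.card_univ] at hlow
  have hK : K 0 * K 1 = (2 * G * ρ + 2) ^ (n * (N 0 + N 1)) * Real.exp (4 * n) := by
    simp only [K]
    rw [mul_mul_mul_comm, ← pow_add, ← Real.exp_add, hs]
    congr 2
    · ring
    · ring
  have := hsum 0
  have := hsum 1
  linarith

/-- The total rate at power `ρ` is at most `(N 0 + N 1) log₂ ρ` up to an additive constant. -/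
theorem sum_rates_le {allowed : (n : ℕ) → Code M N n → Prop} {ρ : ℝ} (hρ : 1 ≤ ρ) {G : ℝ}
    (hG0 : 0 ≤ G) (hG : ∀ r (x : (t : Fin 2) → Fin (M t) → ℂ),
      ∑ i, ‖(∑ t, H.mat r t *ᵥ x t) i‖ ^ 2 ≤ G * ∑ t, ∑ j, ‖x t j‖ ^ 2)
    {R : Fin 2 → Fin 2 → ℝ} (h : AchievableRates allowed H ρ R) :
    ∑ r, ∑ t, R r t ≤ ((N 0 : ℝ) + N 1) * Real.logb 2 ρ +
      (2 + ((N 0 : ℝ) + N 1) * Real.logb 2 (2 * G + 2) + 4 * Real.logb 2 (Real.exp 1)) := by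
  obtain ⟨n₀, hn⟩ := h (1 / 4) (by norm_num)
  obtain ⟨n, hn0, hn1⟩ : ∃ n, n₀ ≤ n ∧ 1 ≤ n := ⟨n₀ + 1, Nat.le_succ _, by omega⟩
  obtain ⟨c, -, hc, hr, he⟩ := hn n hn0
  have hρ0 : 0 < ρ := by linarith
  have hcard := c.card_msgs_le hρ0 hc hG0 hG he
  have hn1 : (1 : ℝ) ≤ n := by exact_mod_cast hn1
  have hmsg (r t) : ((c.msg r t : ℕ) : ℝ) ≠ 0 := by exact_mod_cast (c.msg_pos r t).ne'
  have hlogW : Real.logb 2 (Fintype.card c.Msgs) = ∑ r, ∑ t, Real.logb 2 (c.msg r t) := by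
    rw [Fintype.card_pi]
    simp only [Fintype.card_pi, Fintype.card_fin]
    push_cast
    rw [Real.logb_prod _ _ fun r _ => Finset.prod_ne_zero_iff.2 fun t _ => hmsg r t]
    exact Finset.sum_congr rfl fun r _ => Real.logb_prod _ _ fun t _ => hmsg r t
  have hcard0 : (0 : ℝ) < Fintype.card c.Msgs := by
    have : Nonempty c.Msgs := ⟨fun r t => ⟨0, c.msg_pos r t⟩⟩
    exact_mod_cast Fintype.card_pos
  have hbase : 0 < 2 * G * ρ + 2 := by positivity
  have hlog := Real.logb_le_logb_of_le one_lt_two hcard0 hcard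
  rw [hlogW, Real.logb_mul two_ne_zero (by positivity), Real.logb_mul (by positivity)
    (by positivity), Real.logb_pow, Real.logb_self_eq_one one_lt_two,
    show Real.exp (4 * n) = Real.exp 1 ^ (4 * n) by rw [← Real.exp_nat_mul]; simp,
    Real.logb_pow] at hlog
  have hs : Real.logb 2 (2 * G * ρ + 2) ≤ Real.logb 2 ρ + Real.logb 2 (2 * G + 2) := by
    rw [← Real.logb_mul (by positivity) (by positivity)]
    exact Real.logb_le_logb_of_le one_lt_two hbase (by nlinarith)
  have hsum : (n : ℝ) * (∑ r, ∑ t, R r t - 1) ≤ ∑ r, ∑ t, Real.logb 2 (c.msg r t) := by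
    have := add_le_add (add_le_add (hr 0 0) (hr 0 1)) (add_le_add (hr 1 0) (hr 1 1))
    simp only [Fin.sum_univ_two]
    linarith
  have hN : (0 : ℝ) ≤ (N 0 : ℝ) + N 1 := by positivity
  have hs' := mul_le_mul_of_nonneg_left hs hN
  push_cast at hlog
  have h1 : (n : ℝ) * (∑ r, ∑ t, R r t - 1) ≤
      n * (1 + ((N 0 : ℝ) + N 1) * Real.logb 2 (2 * G * ρ + 2) +
        4 * Real.logb 2 (Real.exp 1)) := by
    linarith
  have h2 := le_of_mul_le_mul_left h1 (by linarith)
  linarith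

theorem AchievableDoF.sum_le {allowed : (n : ℕ) → Code M N n → Prop} {d : Fin 2 → Fin 2 → ℝ}
    (h : AchievableDoF allowed H d) : ∑ r, ∑ t, d r t ≤ (N 0 : ℝ) + N 1 := by
  obtain ⟨R, hR, hlim⟩ := h
  obtain ⟨G, hG0, hG⟩ := exists_gain H
  set C := 2 + ((N 0 : ℝ) + N 1) * Real.logb 2 (2 * G + 2) + 4 * Real.logb 2 (Real.exp 1)
  have h1 : Tendsto (fun ρ => ∑ r, ∑ t, R ρ r t / Real.logb 2 ρ) atTop (𝓝 (∑ r, ∑ t, d r t)) :=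
    tendsto_finsetSum _ fun r _ => tendsto_finsetSum _ fun t _ => hlim r t
  have h2 : Tendsto (fun ρ => ((N 0 : ℝ) + N 1) + C / Real.logb 2 ρ) atTop
      (𝓝 ((N 0 : ℝ) + N 1 + 0)) :=
    ((Real.tendsto_logb_atTop one_lt_two).const_div_atTop C).const_add _
  rw [add_zero] at h2
  refine le_of_tendsto_of_tendsto h1 h2 ?_
  filter_upwards [eventually_gt_atTop 1] with ρ hρ
  have hl : 0 < Real.logb 2 ρ := Real.logb_pos one_lt_two hρ
  have := sum_rates_le hρ.le hG0 hG (hR ρ (by linarith))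
  simp only [← Finset.sum_div]
  rw [div_le_iff₀ hl, add_mul, div_mul_cancel₀ _ hl.ne']
  exact this

end Converse

/-! ### The maximal number of degrees of freedom of the scheme -/

section Maximum

variable {M N : Fin 2 → ℕ} {H : Channel M N}

theorem Generic.isGreatest_square (hH : Generic H) (hM : M 1 = N 0) (hN : N 0 = N 1)
    (h2 : 2 ≤ N 0) (hB : 2 * N 0 + N 1 ≤ M 0 + M 1) :
    IsGreatest (schemeDoFs H) ((N 0 : ℝ) + N 1 - 1) ∧
      ∃ P : Precoding M, IsScheme H P ∧ P.dof = (N 0 : ℝ) + N 1 - 1 ∧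
        P.Q 0 0 = 2 * N 0 - 2 ∧ P.Q 1 0 = 2 * N 1 - 2 ∧ P.Q 0 1 = 1 ∧ P.Q 1 1 = 1 := by
  obtain ⟨n, hn⟩ := Nat.exists_eq_add_of_le' h2
  obtain ⟨P, hP, hQ⟩ := hH.exists_scheme_square (n := n)
    (Fin.forall_fin_two.2 ⟨hn, hN ▸ hn⟩) (hM.trans hn) (by omega)
  have hdof : P.dof = (N 0 : ℝ) + N 1 - 1 := by
    rw [P.dof_eq, (hQ 0).1, (hQ 0).2, (hQ 1).1, (hQ 1).2, ← hN, hn]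
    push_cast
    ring
  refine ⟨⟨⟨P, hP, hdof⟩, ?_⟩, P, hP, hdof, ?_, ?_, (hQ 0).2, (hQ 1).2⟩
  · rintro _ ⟨P', hP', rfl⟩
    have h0 : 1 ≤ P'.len₃ 0 0 := hP'.one_le_len₃ (hH.injective_one (r := 1) (hM.trans hN))
    have h1 : 1 ≤ P'.len₃ 1 0 := hP'.one_le_len₃ (hH.injective_one (r := 0) hM)
    have h3 : ((2 : ℕ) : ℝ) ≤ (P'.len₃ 0 0 + P'.len₃ 1 0 : ℕ) := by
      exact_mod_cast (by omega)
    have := hP'.dof_le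
    push_cast at h3 this
    linarith
  · rw [(hQ 0).1]; omega
  · rw [(hQ 1).1]; omega

theorem Generic.isGreatest_unequal (hH : Generic H) (hM : M 1 = N 0) (hN : N 1 < N 0)
    (hpos : 1 ≤ N 1) (hB : 2 * N 0 + N 1 ≤ M 0 + M 1) :
    IsGreatest (schemeDoFs H) ((N 0 : ℝ) + N 1 - 1 / 2) ∧
      ∃ P : Precoding M, IsScheme H P ∧ P.dof = (N 0 : ℝ) + N 1 - 1 / 2 ∧
        P.Q 0 0 = 2 * N 1 - 1 ∧ P.Q 1 0 = 2 * N 1 - 1 ∧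
        P.Q 0 1 = 2 * (M 1 - N 1) ∧ P.Q 1 1 = 1 := by
  obtain ⟨n, hn⟩ := Nat.exists_eq_add_of_le' hpos
  obtain ⟨q, hq⟩ := Nat.exists_eq_add_of_lt hN
  obtain ⟨P, hP, h00, h10, h01, h11⟩ := hH.exists_scheme_unequal (n := n) (q := q + 1) hn
    (by omega) (by omega) hM (by omega)
  have hdof : P.dof = (N 0 : ℝ) + N 1 - 1 / 2 := by
    rw [P.dof_eq, h00, h10, h01, h11, hq, hn]
    push_cast
    ring
  refine ⟨⟨⟨P, hP, hdof⟩, ?_⟩, P, hP, hdof, by omega, by omega, by omega, h11⟩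
  rintro _ ⟨P', hP', rfl⟩
  have h1 : 1 ≤ P'.len₃ 1 0 := hP'.one_le_len₃ (hH.injective_one (r := 0) hM)
  have h3 : ((1 : ℕ) : ℝ) ≤ (P'.len₃ 0 0 + P'.len₃ 1 0 : ℕ) := by
    exact_mod_cast (by omega)
  have := hP'.dof_le
  push_cast at h3 this
  linarith

theorem Generic.isGreatest_zeroForcing (hH : Generic H) (hM : M 1 ≤ M 0) (hMN : N 0 < M 1)
    (hN : N 1 ≤ N 0) (hpos : 1 ≤ N 1) (hB : 2 * N 0 + N 1 ≤ M 0 + M 1) :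
    IsGreatest (schemeDoFs H) ((N 0 : ℝ) + N 1) ∧
      ∃ P : Precoding M, IsScheme H P ∧ P.dof = (N 0 : ℝ) + N 1 ∧
        P.Q 0 0 = 2 * N 0 - min (2 * (M 1 - N 1)) (N 0) ∧
        P.Q 1 0 = 2 * N 1 - min (2 * (M 1 - N 0)) (N 1) ∧
        P.Q 0 1 = min (2 * (M 1 - N 1)) (N 0) ∧
        P.Q 1 1 = min (2 * (M 1 - N 0)) (N 1) := by
  obtain ⟨P, hP, hQ⟩ := hH.exists_scheme_zeroForcing
    (Q := fun r t => if t = 0 then 2 * N r - min (2 * (M 1 - N (other r))) (N r)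
      else min (2 * (M 1 - N (other r))) (N r))
    (by simp only [Fin.forall_fin_two, other, Fin.isValue, Fin.rev_zero, Fin.reduceLast,
          Fin.reduceRev, if_true, one_ne_zero, if_false]
        omega)
    (by simp only [Fin.forall_fin_two, other, Fin.isValue, Fin.rev_zero, Fin.reduceLast,
          Fin.reduceRev, if_true, one_ne_zero, if_false]
        omega)
    (by simp only [Fin.forall_fin_two, other, Fin.isValue, Fin.rev_zero, Fin.reduceLast,
          Fin.reduceRev, if_true, one_ne_zero, if_false]
        omega)
  have h00 : P.Q 0 0 = 2 * N 0 - min (2 * (M 1 - N 1)) (N 0) := by rw [hQ]; rfl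
  have h10 : P.Q 1 0 = 2 * N 1 - min (2 * (M 1 - N 0)) (N 1) := by rw [hQ]; rfl
  have h01 : P.Q 0 1 = min (2 * (M 1 - N 1)) (N 0) := by rw [hQ]; rfl
  have h11 : P.Q 1 1 = min (2 * (M 1 - N 0)) (N 1) := by rw [hQ]; rfl
  have hdof : P.dof = (N 0 : ℝ) + N 1 := by
    rw [P.dof_eq, show P.Q 0 0 + P.Q 0 1 + (P.Q 1 0 + P.Q 1 1) = 2 * N 0 + 2 * N 1 by omega]
    push_cast
    ring
  refine ⟨⟨⟨P, hP, hdof⟩, ?_⟩, P, hP, hdof, h00, h10, h01, h11⟩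
  rintro _ ⟨P', hP', rfl⟩
  have h3 : (0 : ℝ) ≤ (P'.len₃ 0 0 + P'.len₃ 1 0 : ℕ) := Nat.cast_nonneg _
  have := hP'.dof_le
  linarith

end Maximum

end MimoX

theorem theorem2 (M N : Fin 2 → ℕ)
    (hM : M 1 ≤ M 0) (hMN : N 0 ≤ M 1) (hN : N 1 ≤ N 0) (hpos : 1 ≤ N 1)
    (hB : 2 * N 0 + N 1 ≤ M 0 + M 1)
    (m : Fin 2 → Fin 2 → ℂ) (v : Fin 2 → Fin 2 → ℝ≥0) (hv : ∀ r t, v r t ≠ 0) :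
    ∀ᵐ H ∂(MimoX.channelLaw M N m v),
      -- every choice of precoders for the scheme achieves 1/2 DoF per real stream
      (∀ P : MimoX.Precoding M, MimoX.IsScheme H P →
        MimoX.AchievableDoF (fun _ c => c.UsesPrecoding P) H (fun r t => (P.Q r t : ℝ) / 2)) ∧
      -- the outer bound on the total DoF of the channel
      (∀ d : Fin 2 → Fin 2 → ℝ, MimoX.AchievableDoF (fun _ _ => True) H d →
        ∑ r, ∑ t, d r t ≤ (N 0 : ℝ) + N 1) ∧
      -- subcase (1)
      (M 1 = N 0 → N 0 = N 1 → 2 ≤ N 0 →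
        IsGreatest (MimoX.schemeDoFs H) ((N 0 : ℝ) + N 1 - 1) ∧
        ∃ P : MimoX.Precoding M, MimoX.IsScheme H P ∧ P.dof = (N 0 : ℝ) + N 1 - 1 ∧
          P.Q 0 0 = 2 * N 0 - 2 ∧ P.Q 1 0 = 2 * N 1 - 2 ∧ P.Q 0 1 = 1 ∧ P.Q 1 1 = 1) ∧
      -- subcase (2)
      (M 1 = N 0 → N 1 < N 0 →
        IsGreatest (MimoX.schemeDoFs H) ((N 0 : ℝ) + N 1 - 1 / 2) ∧
        ∃ P : MimoX.Precoding M, MimoX.IsScheme H P ∧ P.dof = (N 0 : ℝ) + N 1 - 1 / 2 ∧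
          P.Q 0 0 = 2 * N 1 - 1 ∧ P.Q 1 0 = 2 * N 1 - 1 ∧
          P.Q 0 1 = 2 * (M 1 - N 1) ∧ P.Q 1 1 = 1) ∧
      -- subcase (3)
      (N 0 < M 1 →
        IsGreatest (MimoX.schemeDoFs H) ((N 0 : ℝ) + N 1) ∧
        ∃ P : MimoX.Precoding M, MimoX.IsScheme H P ∧ P.dof = (N 0 : ℝ) + N 1 ∧
          P.Q 0 0 = 2 * N 0 - min (2 * (M 1 - N 1)) (N 0) ∧
          P.Q 1 0 = 2 * N 1 - min (2 * (M 1 - N 0)) (N 1) ∧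
          P.Q 0 1 = min (2 * (M 1 - N 1)) (N 0) ∧
          P.Q 1 1 = min (2 * (M 1 - N 0)) (N 1)) := by

  filter_upwards [MimoX.ae_generic hM hMN hN hB m hv] with H hH
  exact ⟨fun P hP => hP.achievableDoF, fun d hd => hd.sum_le,
    fun h1 h2 h3 => hH.isGreatest_square h1 h2 h3 hB,
    fun h1 h2 => hH.isGreatest_unequal h1 h2 hpos hB,
    fun h1 => hH.isGreatest_zeroForcing hM h1 hN hpos hB⟩
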